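/- Let $A$ be a totally ordered integral domain. **Algebras.** An $\ell$-algebra over $A$ is a commutative ring $S$ with $1$ that is an $A$-algebra and a lattice such that $s\le t$ implies $s+u\le t+u$, and such that $st\ge 0$ and $as\ge 0$ whenever $s,t\ge 0$ in $S$ and $a\ge 0$ in $A$; it is an $f$-algebra if its underlying ring is a subdirect product of totally ordered rings. $\mathrm{Id}(S)$ denotes the Boolean algebra of idempotents of $S$ (with $e\wedge k=ek$, $e\vee k=e+k-ek$, $\neg e=1-e$). $S$ is a *Specker $A$-algebra* if it is generated as an $A$-algebra by a Boolean subalgebra of $\mathrm{Id}(S)$ each of whose nonzero elements $e$ is faithful, i.e. $ae=0$ implies $a=0$ for $a\in A$. A *proximity Specker $A$-algebra* is a pair $(S,\prec)$, where $S$ is a Specker $A$-algebra that is a torsion-free $f$-algebra over $A$, and $\prec$ is a proximity on $S$, i.e. a binary relation such that: 1. $0\prec 0$ and $1\prec 1$; 2. $s\prec t$ implies $s\le t$; 3. $s\le t\prec r\le u$ implies $s\prec u$; 4. $s\prec t$ and $s\prec r$ imply $s\prec t\wedge r$; 5. $s\prec t$ implies $-t\prec -s$; 6. $s\prec t$ and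 $r\prec u$ imply $s+r\prec t+u$; 7. for every $0<a\in A$: $s\prec t$ if and only if $as\prec at$; 8. $s,t,r,u\ge 0$, $s\prec t$ and $r\prec u$ imply $sr\prec tu$; 9. $s\prec t$ implies that there is $r\in S$ with $s\prec r\prec t$; 10. $s>0$ implies that there is $t\in S$ with $0<t\prec s$. **Ends.** An ideal $I$ of the Boolean algebra $\mathrm{Id}(S)$ is *round* if $I=\{a : a\prec e \text{ for some } e\in I\}$. An *end* of $(\mathrm{Id}(S),\prec)$ is an ideal that is maximal among the proper round ideals. The *space of ends* $X$ is the set of ends with the topology that has the sets $\zeta(a)=\{x\in X : a\in x\}$, $a\in \mathrm{Id}(S)$, as a basis. **Normal functions.** For $a\in A$ put ${\uparrow}a=\{b\in A : a\le b\}$. $FN(X)$ is the set of functions $f:X\to A$ with finite image for which $f^{-1}({\uparrow}a)$ is regular open for every $a\in A$. The normalization of a function $f:X\to A$ with finite image is the unique $f^\#\in FN(X)$ with $(f^\#)^{-1}({\uparrow}a)=\mathrm{Int}(\mathrm{Cl}(f^{-1}({\uparrow}a)))$ for all $a\in A$. $FN(X)$ is an $\ell$-algebra over $A$ under the pointwise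 order, its sum, product, negation, scalar multiplication and join being the normalizations of the pointwise ones and its meet being the pointwise meet. For $f,g\in FN(X)$ write $f\prec_X g$ if $\mathrm{Cl}(f^{-1}({\uparrow}a))\subseteq g^{-1}({\uparrow}a)$ for every $a\in A$. **Theorem.** Let $(S,\prec)$ be a proximity Specker $A$-algebra and let $X$ be the space of ends of $(\mathrm{Id}(S),\prec)$. Then $X$ is compact Hausdorff, and there is an injective $A$-algebra homomorphism $\eta:S\to FN(X)$ preserving binary meets and joins (an $\ell$-algebra embedding) such that - $\eta[S]$ is dense in $FN(X)$: whenever $f\prec_X g$ in $FN(X)$, there is $s\in S$ with $f\prec_X\eta(s)\prec_X g$; and - for all $s,t\in S$, $s\prec t$ if and only if $\eta(s)\prec_X\eta(t)$. -/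

import Mathlib

open Set Filter Topology

noncomputable section

/-! ## Idempotents, Specker algebras -/

/-- The type of idempotents of a commutative ring. -/
def Idem (S : Type*) [CommRing S] : Type _ := {e : S // IsIdempotentElem e}

/-- The Boolean algebra of idempotents: `e ≤ k ↔ e * k = e`, `e ⊓ k = e * k`,
`e ⊔ k = e + k - e * k`, `eᶜ = 1 - e`. This order is defined from the ring structure alone. -/
instance (S : Type*) [CommRing S] : BooleanAlgebra (Idem S) :=
  inferInstanceAs (BooleanAlgebra {e : S // IsIdempotentElem e})

namespace Idem

variable {S : Type*} [CommRing S]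

theorem le_iff (e k : Idem S) : e ≤ k ↔ e.1 * k.1 = e.1 := Iff.rfl

theorem val_inf (e k : Idem S) : (e ⊓ k).1 = e.1 * k.1 := rfl

theorem val_sup (e k : Idem S) : (e ⊔ k).1 = e.1 + k.1 - e.1 * k.1 := rfl

theorem val_compl (e : Idem S) : (eᶜ).1 = 1 - e.1 := rfl

theorem val_top : (⊤ : Idem S).1 = 1 := rfl

theorem val_bot : (⊥ : Idem S).1 = 0 := rfl

/-- The restriction to the idempotents of a relation on the ring. -/
def restrict (r : S → S → Prop) : Idem S → Idem S → Prop := fun e k => r e.1 k.1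

end Idem

/-- A Specker `A`-algebra: generated as an `A`-algebra by a Boolean subalgebra of its idempotents
all of whose nonzero elements are faithful. -/
def IsSpecker (A S : Type*) [CommRing A] [CommRing S] [Algebra A S] : Prop :=
  ∃ B : BooleanSubalgebra (Idem S),
    (∀ e ∈ B, e.1 ≠ 0 → ∀ a : A, a • e.1 = 0 → a = 0) ∧
    Algebra.adjoin A {s : S | ∃ e ∈ B, e.1 = s} = ⊤

/-! ## `ℓ`-algebras and `f`-algebras -/

/-- Compatibility of a lattice order with the structure of an algebra over a totally ordered
ring `A`: the algebra is an `ℓ`-algebra. -/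
structure IsLAlgebra (A S : Type*) [CommRing A] [LinearOrder A] [CommRing S] [Lattice S]
    [Algebra A S] : Prop where
  add_le_add : ∀ s t u : S, s ≤ t → s + u ≤ t + u
  mul_nonneg : ∀ s t : S, 0 ≤ s → 0 ≤ t → 0 ≤ s * t
  smul_nonneg : ∀ (a : A) (s : S), 0 ≤ a → 0 ≤ s → 0 ≤ a • s

/-- A commutative ring with a lattice order is an `f`-ring if it is a subdirect product of totally
ordered rings: it embeds, as a ring and as a lattice, in a product of totally ordered rings so
that every coordinate map is onto. -/
def IsFRing.{v} (S : Type v) [CommRing S] [Lattice S] : Prop :=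
  ∃ (ι : Type v) (T : ι → Type v) (_ : ∀ i, CommRing (T i)) (_ : ∀ i, LinearOrder (T i))
    (φ : ∀ i, S →+* T i),
    (∀ i, IsOrderedRing (T i)) ∧
    (∀ i, Function.Surjective (φ i)) ∧
    (∀ i s t, φ i (s ⊓ t) = φ i s ⊓ φ i t) ∧
    (∀ i s t, φ i (s ⊔ t) = φ i s ⊔ φ i t) ∧
    (∀ s t, (∀ i, φ i s = φ i t) → s = t)

/-- An `f`-algebra is an `ℓ`-algebra whose underlying ring is an `f`-ring. -/
structure IsFAlgebra (A S : Type*) [CommRing A] [LinearOrder A] [CommRing S] [Lattice S]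
    [Algebra A S] : Prop extends IsLAlgebra A S where
  isFRing : IsFRing S

/-! ## Proximities -/

/-- A proximity on a (torsion-free `f`-)algebra `S` over a totally ordered ring `A`. -/
structure IsProximity (A : Type*) {S : Type*} [CommRing A] [LinearOrder A] [CommRing S]
    [Lattice S] [Algebra A S] (r : S → S → Prop) : Prop where
  zero_zero : r 0 0
  one_one : r 1 1
  le : ∀ {s t}, r s t → s ≤ t
  le_trans_le : ∀ {s t u v}, s ≤ t → r t u → u ≤ v → r s v
  inf : ∀ {s t u}, r s t → r s u → r s (t ⊓ u)
  neg : ∀ {s t}, r s t → r (-t) (-s)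
  add : ∀ {s t u v}, r s t → r u v → r (s + u) (t + v)
  smul : ∀ {s t} {a : A}, 0 < a → r s t → r (a • s) (a • t)
  of_smul : ∀ {s t} {a : A}, 0 < a → r (a • s) (a • t) → r s t
  mul : ∀ {s t u v}, 0 ≤ s → 0 ≤ t → 0 ≤ u → 0 ≤ v → r s t → r u v → r (s * u) (t * v)
  interpolate : ∀ {s t}, r s t → ∃ u, r s u ∧ r u t
  exists_pos : ∀ {s}, 0 < s → ∃ t, 0 < t ∧ r t s

/-- `(S, r)` is a proximity Specker `A`-algebra: `S` is a Specker `A`-algebra and a torsion-free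
`f`-algebra over `A`, and `r` is a proximity on `S`. -/
structure IsProximitySpecker (A : Type*) {S : Type*} [CommRing A] [LinearOrder A] [CommRing S]
    [Lattice S] [Algebra A S] (r : S → S → Prop) : Prop where
  isFAlgebra : IsFAlgebra A S
  torsionFree : Module.IsTorsionFree A S
  isSpecker : IsSpecker A S
  isProximity : IsProximity A r

/-- A subset `T` is dense with respect to the relation `r` if whenever `r s u` there is `t ∈ T`
with `r s t` and `r t u`. -/
def IsProxDense {S : Type*} (r : S → S → Prop) (T : Set S) : Prop :=
  ∀ s u, r s u → ∃ t ∈ T, r s t ∧ r t u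

/-! ## The space of ends -/

section Ends

variable {B : Type*} [BooleanAlgebra B]

/-- An ideal `I` is round if `I = {a | a ≺ e for some e ∈ I}`. -/
def IsRound (r : B → B → Prop) (I : Order.Ideal B) : Prop :=
  (I : Set B) = {a | ∃ e ∈ I, r a e}

/-- The ends of `(B, r)`: ideals maximal (for inclusion) among the proper round ideals. -/
def EndSpace (r : B → B → Prop) : Type _ :=
  {I : Order.Ideal B // Maximal (fun J : Order.Ideal B => J.IsProper ∧ IsRound r J) I}

namespace EndSpace

variable {r : B → B → Prop}

/-- The basic set `ζ(a) = {x | a ∈ x}`. -/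
def zeta (r : B → B → Prop) (a : B) : Set (EndSpace r) := {x | a ∈ x.1}

/-- The topology on the space of ends, with basis the sets `ζ(a)`. -/
instance : TopologicalSpace (EndSpace r) := TopologicalSpace.generateFrom (range (zeta r))

theorem isTopologicalBasis_zeta :
    TopologicalSpace.IsTopologicalBasis (range (zeta r)) where
  exists_subset_inter := by
    rintro _ ⟨a, rfl⟩ _ ⟨b, rfl⟩ x ⟨ha, hb⟩
    exact ⟨zeta r (a ⊔ b), mem_range_self _, Order.Ideal.sup_mem ha hb, fun y hy =>
      ⟨y.1.lower le_sup_left hy, y.1.lower le_sup_right hy⟩⟩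
  sUnion_eq := eq_univ_of_forall fun x =>
    ⟨zeta r ⊥, mem_range_self _, Order.Ideal.bot_mem x.1⟩
  eq_generateFrom := rfl

end EndSpace

end Ends

/-! ## Finitely valued normal functions -/

/-- The set of finitely valued normal functions from `X` to `A`: functions with finite range for
which the preimage of every `↑a = {b | a ≤ b}` is regular open. -/
structure FN (X A : Type*) [TopologicalSpace X] [LinearOrder A] where
  toFun : X → A
  finite_range : (range toFun).Finite
  regularOpen : ∀ a, interior (closure (toFun ⁻¹' Ici a)) = toFun ⁻¹' Ici a

namespace FN

section Order

variable {X A : Type*} [TopologicalSpace X] [LinearOrder A]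

instance : FunLike (FN X A) X A where
  coe := toFun
  coe_injective f g h := by cases f; cases g; congr

@[simp] theorem coe_mk (f : X → A) (h₁ h₂) : ⇑(⟨f, h₁, h₂⟩ : FN X A) = f := rfl

theorem finite_range' (f : FN X A) : (range f).Finite := f.finite_range

theorem regularOpen' (f : FN X A) (a : A) : interior (closure (f ⁻¹' Ici a)) = f ⁻¹' Ici a :=
  f.regularOpen a

theorem isOpen_preimage (f : FN X A) (a : A) : IsOpen (f ⁻¹' Ici a) := by
  rw [← f.regularOpen']; exact isOpen_interior

/-- The (finite) set of values `a` of `f` such that `x ∈ Int (Cl (f⁻¹(↑a)))`. -/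
def normValues (f : X → A) (hf : (range f).Finite) (x : X) : Finset A :=
  open Classical in hf.toFinset.filter fun a => x ∈ interior (closure (f ⁻¹' Ici a))

theorem mem_normValues {f : X → A} {hf : (range f).Finite} {x : X} {a : A} :
    a ∈ normValues f hf x ↔ a ∈ range f ∧ x ∈ interior (closure (f ⁻¹' Ici a)) := by
  classical
  simp [normValues]

theorem normValues_nonempty (f : X → A) (hf : (range f).Finite) (x : X) :
    (normValues f hf x).Nonempty := by
  obtain ⟨m, hm, hmin⟩ := hf.exists_minimal ⟨f x, mem_range_self x⟩
  refine ⟨m, mem_normValues.2 ⟨hm, ?_⟩⟩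
  have : f ⁻¹' Ici m = univ := eq_univ_of_forall fun y => by
    rcases le_total m (f y) with h | h
    · exact h
    · exact hmin (mem_range_self y) h
  simp [this]

/-- The values of the normalization `f^#`: if `a₀ < ⋯ < aₙ` are the values of `f`,
`Uᵢ = Int (Cl (f⁻¹(↑aᵢ)))` and `Uₙ₊₁ = ∅`, then `f^# x = aᵢ` for `x ∈ Uᵢ \ Uᵢ₊₁`; in other words
`f^# x` is the greatest `aᵢ` with `x ∈ Uᵢ`. -/
def normFun (f : X → A) (hf : (range f).Finite) (x : X) : A :=
  (normValues f hf x).max' (normValues_nonempty f hf x)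

theorem le_normFun_iff (f : X → A) (hf : (range f).Finite) (x : X) (a : A) :
    a ≤ normFun f hf x ↔ x ∈ interior (closure (f ⁻¹' Ici a)) := by
  constructor
  · intro h
    have h2 := (mem_normValues.1 ((normValues f hf x).max'_mem (normValues_nonempty f hf x))).2
    exact interior_mono (closure_mono (preimage_mono (Ici_subset_Ici.2 h))) h2
  · intro hx
    have hne : (range f ∩ Ici a).Nonempty := by
      obtain ⟨y, hy⟩ := closure_nonempty_iff.1 ⟨x, interior_subset hx⟩
      exact ⟨f y, mem_range_self y, hy⟩
    obtain ⟨m, hm, hmin⟩ := (hf.subset inter_subset_left).exists_minimal hne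
    have heq : f ⁻¹' Ici a ⊆ f ⁻¹' Ici m := fun y hy => by
      rcases le_total m (f y) with h | h
      · exact h
      · exact hmin ⟨mem_range_self y, hy⟩ h
    exact (mem_Ici.1 hm.2).trans (Finset.le_max' _ _ (mem_normValues.2
      ⟨hm.1, interior_mono (closure_mono heq) hx⟩))

/-- The normalization `f^#` of a finitely valued function `f`. -/
def normalize (f : X → A) (hf : (range f).Finite) : FN X A where
  toFun := normFun f hf
  finite_range := hf.subset <| by
    rintro _ ⟨x, rfl⟩
    exact (mem_normValues.1 ((normValues f hf x).max'_mem (normValues_nonempty f hf x))).1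
  regularOpen a := by
    have : normFun f hf ⁻¹' Ici a = interior (closure (f ⁻¹' Ici a)) := by
      ext x; exact le_normFun_iff f hf x a
    rw [this, interior_closure_idem]

theorem le_normalize_iff {f : X → A} {hf : (range f).Finite} {x : X} {a : A} :
    a ≤ normalize f hf x ↔ x ∈ interior (closure (f ⁻¹' Ici a)) :=
  le_normFun_iff f hf x a

theorem finite_range_op₂ {op : A → A → A} (f g : FN X A) :
    (range fun x => op (f x) (g x)).Finite :=
  (f.finite_range'.image2 op g.finite_range').subset <| by
    rintro _ ⟨x, rfl⟩
    exact mem_image2_of_mem (mem_range_self x) (mem_range_self x)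

theorem finite_range_op₁ {op : A → A} (f : FN X A) : (range fun x => op (f x)).Finite :=
  (f.finite_range'.image op).subset <| by
    rintro _ ⟨x, rfl⟩
    exact mem_image_of_mem _ (mem_range_self x)

/-- Lift of a unary operation on `A` to `FN X A`: the normalization of the pointwise operation. -/
def lift₁ (op : A → A) (f : FN X A) : FN X A :=
  normalize (fun x => op (f x)) (finite_range_op₁ f)

/-- Lift of a binary operation on `A` to `FN X A`: the normalization of the pointwise operation. -/
def lift₂ (op : A → A → A) (f g : FN X A) : FN X A :=
  normalize (fun x => op (f x) (g x)) (finite_range_op₂ f g)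

/-- The constant function with value `a`. -/
def const (a : A) : FN X A where
  toFun _ := a
  finite_range := (finite_singleton a).subset (by rintro _ ⟨_, rfl⟩; rfl)
  regularOpen b := by by_cases h : b ≤ a <;> simp [h]

@[simp] theorem const_apply (a : A) (x : X) : (const a : FN X A) x = a := rfl

/-- The pointwise order. -/
instance : PartialOrder (FN X A) := PartialOrder.lift (fun f => (f : X → A)) DFunLike.coe_injective

theorem le_def {f g : FN X A} : f ≤ g ↔ ∀ x, f x ≤ g x := Iff.rfl

theorem le_lift_sup {k : FN X A} (f g : FN X A) (h : ∀ x, k x ≤ f x ⊔ g x) :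
    k ≤ lift₂ (· ⊔ ·) f g := by
  intro x
  have hx : x ∈ k ⁻¹' Ici (k x) := mem_preimage.2 le_rfl
  rw [← k.regularOpen'] at hx
  refine le_normalize_iff.2 (interior_mono (closure_mono fun y hy => ?_) hx)
  exact le_trans (mem_Ici.1 hy) (h y)

theorem lift_sup_le {f g k : FN X A} (h : ∀ x, f x ⊔ g x ≤ k x) :
    lift₂ (· ⊔ ·) f g ≤ k := by
  intro x
  have key : ∀ a : A, a ≤ lift₂ (· ⊔ ·) f g x → x ∈ k ⁻¹' Ici a := fun a ha => by
    rw [← k.regularOpen']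
    refine interior_mono (closure_mono fun y hy => ?_) (le_normalize_iff.1 ha)
    have hy' : a ≤ f y ⊔ g y := hy
    exact hy'.trans (h y)
  exact key _ le_rfl

/-- The lattice `FN X A`: the meet is pointwise, the join is the normalization of the pointwise
join. -/
instance : Lattice (FN X A) where
  inf f g :=
    { toFun := fun x => f x ⊓ g x
      finite_range := finite_range_op₂ f g
      regularOpen := fun a => by
        have h : (fun x => f x ⊓ g x) ⁻¹' Ici a = f ⁻¹' Ici a ∩ g ⁻¹' Ici a := by
          ext x; simp
        rw [h]
        refine Subset.antisymm (subset_inter ?_ ?_) ?_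
        · conv_rhs => rw [← f.regularOpen']
          exact interior_mono (closure_mono inter_subset_left)
        · conv_rhs => rw [← g.regularOpen']
          exact interior_mono (closure_mono inter_subset_right)
        · exact interior_maximal subset_closure
            ((f.isOpen_preimage a).inter (g.isOpen_preimage a)) }
  inf_le_left f g x := inf_le_left
  inf_le_right f g x := inf_le_right
  le_inf f g h hg hh x := le_inf (hg x) (hh x)
  sup := lift₂ (· ⊔ ·)
  le_sup_left f g := le_lift_sup f g fun _ => le_sup_left
  le_sup_right f g := le_lift_sup f g fun _ => le_sup_right
  sup_le f g h hf hg := lift_sup_le fun x => sup_le (hf x) (hg x)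

theorem inf_apply (f g : FN X A) (x : X) : (f ⊓ g) x = f x ⊓ g x := rfl

theorem sup_def (f g : FN X A) : f ⊔ g = lift₂ (· ⊔ ·) f g := rfl

/-- The relation `≺_X`: `f ≺_X g` iff `Cl (f⁻¹(↑a)) ⊆ g⁻¹(↑a)` for all `a`. -/
def prox (f g : FN X A) : Prop := ∀ a : A, closure (f ⁻¹' Ici a) ⊆ g ⁻¹' Ici a

/-! ### Normal functions are determined on dense open sets -/

/-- The filter of sets containing a dense open set. -/
def denseFilter (X : Type*) [TopologicalSpace X] : Filter X where
  sets := {s | Dense (interior s)}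
  univ_sets := by simp
  sets_of_superset hs hst := Dense.mono (interior_mono hst) hs
  inter_sets hs ht := by
    rw [Set.mem_ofPred_eq, interior_inter]
    exact Dense.inter_of_isOpen_left hs ht isOpen_interior

theorem mem_denseFilter {s : Set X} : s ∈ denseFilter X ↔ Dense (interior s) := Iff.rfl

theorem eventually_locConst (f : FN X A) : ∀ᶠ x in denseFilter X, ∀ᶠ y in 𝓝 x, f y = f x := by
  have hopen : IsOpen {x | ∀ᶠ y in 𝓝 x, f y = f x} := isOpen_iff_mem_nhds.2 fun x hx => by
    filter_upwards [eventually_eventually_nhds.2 hx, hx] with y hy hyx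
    filter_upwards [hy] with z hz
    rw [hz, hyx]
  change Dense (interior _)
  rw [hopen.interior_eq, dense_iff_inter_open]
  rintro W hW ⟨w, hw⟩
  obtain ⟨m, ⟨x, hxW, rfl⟩, hmax⟩ :=
    (f.finite_range'.subset (image_subset_range f W)).exists_maximal ⟨f w, mem_image_of_mem f hw⟩
  refine ⟨x, hxW, ?_⟩
  have : W ∩ f ⁻¹' Ici (f x) ∈ 𝓝 x := (hW.inter (f.isOpen_preimage _)).mem_nhds ⟨hxW, le_rfl⟩
  filter_upwards [this] with y hy
  exact le_antisymm (hmax (mem_image_of_mem f hy.1) hy.2) hy.2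

theorem normalize_eventuallyEq {f : X → A} (hf : (range f).Finite)
    (h : ∀ᶠ x in denseFilter X, ∀ᶠ y in 𝓝 x, f y = f x) :
    normalize f hf =ᶠ[denseFilter X] f := by
  filter_upwards [h] with x hx
  have key : ∀ a, a ≤ normalize f hf x ↔ a ≤ f x := fun a => by
    rw [le_normalize_iff]
    constructor
    · intro hxa
      obtain ⟨y, hy, hya⟩ := mem_closure_iff_nhds.1 (interior_subset hxa) _ hx
      exact (mem_Ici.1 hya).trans_eq hy
    · intro ha
      refine interior_mono subset_closure (mem_interior_iff_mem_nhds.2 ?_)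
      filter_upwards [hx] with y hy
      exact ha.trans_eq hy.symm
  exact le_antisymm ((key _).1 le_rfl) ((key _).2 le_rfl)

theorem lift₁_eventuallyEq (op : A → A) (f : FN X A) :
    lift₁ op f =ᶠ[denseFilter X] fun x => op (f x) :=
  normalize_eventuallyEq _ <| by
    filter_upwards [f.eventually_locConst] with x hf
    filter_upwards [hf] with y hy
    rw [hy]

theorem lift₂_eventuallyEq (op : A → A → A) (f g : FN X A) :
    lift₂ op f g =ᶠ[denseFilter X] fun x => op (f x) (g x) :=
  normalize_eventuallyEq _ <| by
    filter_upwards [f.eventually_locConst, g.eventually_locConst] with x hf hg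
    filter_upwards [hf, hg] with y hy hy'
    rw [hy, hy']

theorem le_of_eventuallyLE {f g : FN X A} (h : ∀ᶠ x in denseFilter X, f x ≤ g x) : f ≤ g := by
  intro x
  have hsub : f ⁻¹' Ici (f x) ⊆ closure (g ⁻¹' Ici (f x)) :=
    (Dense.open_subset_closure_inter (mem_denseFilter.1 h) (f.isOpen_preimage _)).trans <|
      closure_mono fun y hy => by
        have h2 : y ∈ {x | f x ≤ g x} := interior_subset hy.2
        rw [Set.mem_ofPred_eq] at h2
        exact (mem_Ici.1 hy.1).trans h2
  have : x ∈ g ⁻¹' Ici (f x) := by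
    rw [← g.regularOpen']
    exact interior_maximal hsub (f.isOpen_preimage _) (mem_preimage.2 le_rfl)
  exact this

theorem ext_eventually {f g : FN X A} (h : f =ᶠ[denseFilter X] g) : f = g :=
  le_antisymm (le_of_eventuallyLE h.le) (le_of_eventuallyLE h.symm.le)

end Order

/-! ### The algebra structure: every operation is the normalization of the pointwise one -/

section Algebra

variable {X A : Type*} [TopologicalSpace X] [CommRing A] [LinearOrder A]

instance : Zero (FN X A) := ⟨const 0⟩
instance : One (FN X A) := ⟨const 1⟩
instance : Add (FN X A) := ⟨lift₂ (· + ·)⟩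
instance : Mul (FN X A) := ⟨lift₂ (· * ·)⟩
instance : Neg (FN X A) := ⟨lift₁ (- ·)⟩
instance : SMul A (FN X A) := ⟨fun a => lift₁ (a * ·)⟩

@[simp] theorem zero_apply (x : X) : (0 : FN X A) x = 0 := rfl
@[simp] theorem one_apply (x : X) : (1 : FN X A) x = 1 := rfl

theorem add_ev (f g : FN X A) : ∀ᶠ x in denseFilter X, (f + g) x = f x + g x :=
  lift₂_eventuallyEq (· + ·) f g

theorem mul_ev (f g : FN X A) : ∀ᶠ x in denseFilter X, (f * g) x = f x * g x :=
  lift₂_eventuallyEq (· * ·) f g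

theorem neg_ev (f : FN X A) : ∀ᶠ x in denseFilter X, (-f) x = -f x :=
  lift₁_eventuallyEq (- ·) f

theorem smul_ev (a : A) (f : FN X A) : ∀ᶠ x in denseFilter X, (a • f) x = a * f x :=
  lift₁_eventuallyEq (a * ·) f

instance : CommRing (FN X A) where
  add_assoc f g h := ext_eventually <| by
    filter_upwards [add_ev (f + g) h, add_ev f g, add_ev f (g + h), add_ev g h] with x h1 h2 h3 h4
    rw [h1, h2, h3, h4, add_assoc]
  zero_add f := ext_eventually <| by
    filter_upwards [add_ev 0 f] with x h1
    rw [h1, zero_apply, zero_add]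
  add_zero f := ext_eventually <| by
    filter_upwards [add_ev f 0] with x h1
    rw [h1, zero_apply, add_zero]
  nsmul := nsmulRec
  add_comm f g := ext_eventually <| by
    filter_upwards [add_ev f g, add_ev g f] with x h1 h2
    rw [h1, h2, add_comm]
  zsmul := zsmulRec
  neg_add_cancel f := ext_eventually <| by
    filter_upwards [add_ev (-f) f, neg_ev f] with x h1 h2
    rw [h1, h2, neg_add_cancel, zero_apply]
  left_distrib f g h := ext_eventually <| by
    filter_upwards [mul_ev f (g + h), add_ev g h, add_ev (f * g) (f * h), mul_ev f g, mul_ev f h]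
      with x h1 h2 h3 h4 h5
    rw [h1, h2, h3, h4, h5, mul_add]
  right_distrib f g h := ext_eventually <| by
    filter_upwards [mul_ev (f + g) h, add_ev f g, add_ev (f * h) (g * h), mul_ev f h, mul_ev g h]
      with x h1 h2 h3 h4 h5
    rw [h1, h2, h3, h4, h5, add_mul]
  zero_mul f := ext_eventually <| by
    filter_upwards [mul_ev 0 f] with x h1
    rw [h1, zero_apply, zero_mul]
  mul_zero f := ext_eventually <| by
    filter_upwards [mul_ev f 0] with x h1
    rw [h1, zero_apply, mul_zero]
  mul_assoc f g h := ext_eventually <| by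
    filter_upwards [mul_ev (f * g) h, mul_ev f g, mul_ev f (g * h), mul_ev g h] with x h1 h2 h3 h4
    rw [h1, h2, h3, h4, mul_assoc]
  one_mul f := ext_eventually <| by
    filter_upwards [mul_ev 1 f] with x h1
    rw [h1, one_apply, one_mul]
  mul_one f := ext_eventually <| by
    filter_upwards [mul_ev f 1] with x h1
    rw [h1, one_apply, mul_one]
  mul_comm f g := ext_eventually <| by
    filter_upwards [mul_ev f g, mul_ev g f] with x h1 h2
    rw [h1, h2, mul_comm]

/-- The `A`-algebra structure, with structure map sending `a` to the constant function `a`. -/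
instance : Algebra A (FN X A) where
  algebraMap :=
    { toFun := const
      map_one' := rfl
      map_zero' := rfl
      map_mul' := fun a b => ext_eventually <| by
        filter_upwards [mul_ev (const a : FN X A) (const b)] with x h1
        rw [h1]; rfl
      map_add' := fun a b => ext_eventually <| by
        filter_upwards [add_ev (const a : FN X A) (const b)] with x h1
        rw [h1]; rfl }
  commutes' a f := mul_comm _ _
  smul_def' a f := ext_eventually <| by
    filter_upwards [smul_ev a f, mul_ev (const a) f] with x h1 h2
    rw [h1]; exact h2.symm

theorem add_def (f g : FN X A) : f + g = lift₂ (· + ·) f g := rfl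
theorem mul_def (f g : FN X A) : f * g = lift₂ (· * ·) f g := rfl
theorem neg_def (f : FN X A) : -f = lift₁ (- ·) f := rfl
theorem smul_def (a : A) (f : FN X A) : a • f = lift₁ (a * ·) f := rfl
theorem algebraMap_def (a : A) : algebraMap A (FN X A) a = const a := rfl

/-- `FN X A` is an `ℓ`-algebra over `A`. -/
theorem isLAlgebra [IsStrictOrderedRing A] : IsLAlgebra A (FN X A) where
  add_le_add f g h hfg := le_of_eventuallyLE <| by
    filter_upwards [add_ev f h, add_ev g h] with x h1 h2
    rw [h1, h2]
    exact add_le_add_left (hfg x) _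
  mul_nonneg f g hf hg := le_of_eventuallyLE <| by
    filter_upwards [mul_ev f g] with x h1
    rw [h1]
    exact mul_nonneg (hf x) (hg x)
  smul_nonneg a f ha hf := le_of_eventuallyLE <| by
    filter_upwards [smul_ev a f] with x h1
    rw [h1]
    exact mul_nonneg ha (hf x)

end Algebra

end FN

end

/-! The proximity restricted to Id(S) is a de Vries proximity on a possibly incomplete Boolean
algebra (`IsProximity.restrict_isDeVries`), so the duality of de Vries applies to its ends. Write
U_a = ζ(aᶜ) (`EndSpace.regularOpen`). These sets are regular open and form a basis, with Cl U_a ⊆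
U_b exactly when a ≺ b (`closure_regularOpen_subset_iff`), and they interpolate between a closed set
and any open set containing it (`exists_regularOpen_between`). Compactness, the Hausdorff property
and the separation of unrelated pairs all come from one alternative,
`exists_sup_eq_top_or_exists_end`: a round generating set either has a finite join equal to ⊤ or
lies in an end.

Since S is generated by idempotents, every s agrees with a scalar on each member of a finite cover
of 1 by idempotents (`IsSpecker.exists_isConstCover`). Hence s has a locally constant value on a
dense open set of ends, and η(s) is the normalization of this partial function. A normal function is
determined by its restriction to a dense open set, so η respects the operations because values do.

The proximity is handled through thresholds: for each a there is an idempotent c that is the truth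
value of a ≤ s. On one side η(s)⁻¹(↑a) = U_c (`represent_preimage_Ici`); on the other, s ≺ t holds
exactly when the thresholds of s are proximal to those of t (`iff_forall_isThreshold`). Together
these give the equivalence of ≺ and ≺_X. Density follows by interpolating a set U_c at each of the
finitely many values of f and joining the resulting step functions. -/

/-! ## De Vries proximities and their ends -/

/-- A de Vries proximity on a (not necessarily complete) Boolean algebra. -/
structure IsDeVries {B : Type*} [BooleanAlgebra B] (r : B → B → Prop) : Prop where
  bot : r ⊥ ⊥
  le : ∀ {a b}, r a b → a ≤ b
  le_trans_le : ∀ {a b c d}, a ≤ b → r b c → c ≤ d → r a d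
  inf : ∀ {a b c}, r a b → r a c → r a (b ⊓ c)
  compl : ∀ {a b}, r a b → r bᶜ aᶜ
  interpolate : ∀ {a b}, r a b → ∃ c, r a c ∧ r c b
  exists_ne_bot : ∀ {a}, a ≠ ⊥ → ∃ b, b ≠ ⊥ ∧ r b a

namespace IsDeVries

variable {B : Type*} [BooleanAlgebra B] {r : B → B → Prop}

theorem mono_left (h : IsDeVries r) {a b c : B} (hab : a ≤ b) (hbc : r b c) : r a c :=
  h.le_trans_le hab hbc le_rfl

theorem mono_right (h : IsDeVries r) {a b c : B} (hab : r a b) (hbc : b ≤ c) : r a c :=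
  h.le_trans_le le_rfl hab hbc

theorem compl_left (h : IsDeVries r) {a b : B} (hab : r aᶜ b) : r bᶜ a := by
  simpa using h.compl hab

theorem sup (h : IsDeVries r) {a b c : B} (hac : r a c) (hbc : r b c) : r (a ⊔ b) c := by
  simpa using h.compl (h.inf (h.compl hac) (h.compl hbc))

theorem finset_sup (h : IsDeVries r) {b : B} (D : Finset B) (hD : ∀ d ∈ D, r d b) :
    r (D.sup id) b := by
  classical
  induction D using Finset.induction_on with
  | empty => simpa using h.mono_right h.bot bot_le
  | insert a s _ ih =>
    rw [Finset.sup_insert]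
    exact h.sup (hD a (Finset.mem_insert_self a s))
      (ih fun d hd => hD d (Finset.mem_insert_of_mem hd))

/-- The ideal generated by a set. -/
def spanIdeal (K : Set B) : Order.Ideal B where
  carrier := {y | ∃ D : Finset B, ↑D ⊆ K ∧ y ≤ D.sup id}
  lower' := fun _ _ hba ⟨D, hD, ha⟩ => ⟨D, hD, hba.trans ha⟩
  nonempty' := ⟨⊥, ∅, by simp, bot_le⟩
  directed' := by
    classical
    rintro a ⟨D, hD, ha⟩ b ⟨E, hE, hb⟩
    refine ⟨a ⊔ b, ⟨D ∪ E, by simp [hD, hE], ?_⟩, le_sup_left, le_sup_right⟩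
    rw [Finset.sup_union]
    exact sup_le_sup ha hb

theorem subset_spanIdeal (K : Set B) {y : B} (hy : y ∈ K) : y ∈ spanIdeal K :=
  ⟨{y}, by simpa using hy, by simp⟩

theorem isRound_iff (h : IsDeVries r) {I : Order.Ideal B} :
    IsRound r I ↔ ∀ a ∈ I, ∃ e ∈ I, r a e := by
  constructor
  · intro hI a ha
    have : a ∈ (I : Set B) := ha
    rw [hI] at this
    exact this
  · intro hI
    ext a
    exact ⟨hI a, fun ⟨e, he, hae⟩ => I.lower (h.le hae) he⟩

theorem isRound_spanIdeal (h : IsDeVries r) {K : Set B} (hK : ∀ d ∈ K, ∃ e ∈ K, r d e) :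
    IsRound r (spanIdeal K) := by
  classical
  rw [h.isRound_iff]
  rintro a ⟨D, hD, ha⟩
  choose! f hf hrf using hK
  refine ⟨(D.image f).sup id, ⟨D.image f, ?_, le_rfl⟩, h.mono_left ha (h.finset_sup D ?_)⟩
  · intro y hy
    obtain ⟨d, hd, rfl⟩ := Finset.mem_image.1 (Finset.mem_coe.1 hy)
    exact hf d (hD hd)
  · exact fun d hd => h.mono_right (hrf d (hD hd))
      (Finset.le_sup (f := id) (Finset.mem_image_of_mem f hd))

theorem exists_end_ge (h : IsDeVries r) {I : Order.Ideal B} (hI : I.IsProper)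
    (hr : IsRound r I) : ∃ x : EndSpace r, I ≤ x.1 := by
  obtain ⟨m, hm, hmax⟩ := zorn_le_nonempty₀ {J : Order.Ideal B | J.IsProper ∧ IsRound r J}
    (fun c hc hchain y hy => by
      refine ⟨sSup c, ?_, fun z hz => le_sSup hz⟩
      -- The supremum of a chain of ideals is its union, because the union `U` is already an ideal.
      have hmem : ∀ a, a ∈ sSup c → ∃ J ∈ c, a ∈ J := by
        intro a ha
        let U : Order.Ideal B :=
          { carrier := {a | ∃ J ∈ c, a ∈ J}
            lower' := fun _ _ hba ⟨J, hJ, ha⟩ => ⟨J, hJ, J.lower hba ha⟩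
            nonempty' := ⟨⊥, y, hy, Order.Ideal.bot_mem y⟩
            directed' := by
              rintro a ⟨J, hJ, ha⟩ b ⟨K, hK, hb⟩
              rcases hchain.total hJ hK with hle | hle
              · exact ⟨a ⊔ b, ⟨K, hK, Order.Ideal.sup_mem (hle ha) hb⟩, le_sup_left,
                  le_sup_right⟩
              · exact ⟨a ⊔ b, ⟨J, hJ, Order.Ideal.sup_mem ha (hle hb)⟩, le_sup_left,
                  le_sup_right⟩ }
        have : sSup c ≤ U := sSup_le fun J hJ b hb => ⟨J, hJ, hb⟩
        exact this ha
      refine ⟨Order.Ideal.isProper_iff_top_notMem.2 fun ht => ?_, h.isRound_iff.2 fun a ha => ?_⟩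
      · obtain ⟨J, hJ, htJ⟩ := hmem _ ht
        exact (hc hJ).1.top_notMem htJ
      · obtain ⟨J, hJ, haJ⟩ := hmem _ ha
        obtain ⟨e, he, hae⟩ := h.isRound_iff.1 (hc hJ).2 a haJ
        exact ⟨e, le_sSup (α := Order.Ideal B) hJ he, hae⟩) I ⟨hI, hr⟩
  exact ⟨⟨m, hmax⟩, hm⟩

/-- A set `K` with `K ⊆ {a | a ≺ e for some e ∈ K}` either has a finite join equal to `⊤` or is
contained in an end. -/
theorem exists_sup_eq_top_or_exists_end (h : IsDeVries r) {K : Set B}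
    (hK : ∀ d ∈ K, ∃ e ∈ K, r d e) :
    (∃ D : Finset B, ↑D ⊆ K ∧ D.sup id = ⊤) ∨ ∃ x : EndSpace r, ∀ d ∈ K, d ∈ x.1 := by
  by_cases hp : (spanIdeal K).IsProper
  · obtain ⟨x, hx⟩ := h.exists_end_ge hp (h.isRound_spanIdeal hK)
    exact .inr ⟨x, fun d hd => hx (subset_spanIdeal K hd)⟩
  · rw [Order.Ideal.isProper_iff_top_notMem, not_not] at hp
    obtain ⟨D, hD, hle⟩ := hp
    exact .inl ⟨D, hD, top_le_iff.1 hle⟩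

theorem exists_mem_end (h : IsDeVries r) (x : EndSpace r) {a : B} (ha : a ∈ x.1) :
    ∃ e ∈ x.1, r a e := h.isRound_iff.1 x.2.1.2 a ha

theorem top_notMem_end (x : EndSpace r) : ⊤ ∉ x.1 := x.2.1.1.top_notMem

theorem notMem_end_of_compl_mem (x : EndSpace r) {a : B} (ha : aᶜ ∈ x.1) : a ∉ x.1 :=
  x.2.1.1.notMem_of_compl_mem ha

theorem finset_sup_mem (I : Order.Ideal B) (D : Finset B) (hD : ∀ d ∈ D, d ∈ I) :
    D.sup id ∈ I := by
  classical
  induction D using Finset.induction_on with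
  | empty => simp
  | insert a s _ ih =>
    rw [Finset.sup_insert]
    exact Order.Ideal.sup_mem (hD a (Finset.mem_insert_self a s))
      (ih fun d hd => hD d (Finset.mem_insert_of_mem hd))

/-- The characteristic property of ends. -/
theorem mem_or_compl_mem_end (h : IsDeVries r) (x : EndSpace r) {a b : B} (hab : r a b) :
    a ∈ x.1 ∨ bᶜ ∈ x.1 := by
  classical
  -- If finitely many members of K join to ⊤, those outside x lie below aᶜ, so a lies below the join
  -- of those in x. Otherwise an end contains K ⊇ x; by maximality it is x, and bᶜ ≺ aᶜ puts bᶜ in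
  -- it.
  rcases h.exists_sup_eq_top_or_exists_end (K := {y | y ∈ x.1 ∨ r y aᶜ}) (by
    rintro d (hd | hd)
    · obtain ⟨e, he, hde⟩ := h.exists_mem_end x hd
      exact ⟨e, .inl he, hde⟩
    · obtain ⟨e, hde, he⟩ := h.interpolate hd
      exact ⟨e, .inr he, hde⟩) with ⟨D, hD, ht⟩ | ⟨y, hy⟩
  · left
    have h1 : (D.filter (· ∈ x.1)).sup id ∈ x.1 := finset_sup_mem _ _ (by simp)
    have h2 : D.sup id ≤ (D.filter (· ∈ x.1)).sup id ⊔ aᶜ := Finset.sup_le fun d hd => by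
      by_cases hdx : d ∈ x.1
      · exact le_sup_of_le_left (Finset.le_sup (f := id) (Finset.mem_filter.2 ⟨hd, hdx⟩))
      · exact le_sup_of_le_right (h.le ((hD hd).resolve_left hdx))
    refine x.1.lower ?_ h1
    rw [ht, top_le_iff] at h2
    simpa using codisjoint_iff_compl_le_left.1 (codisjoint_iff.2 h2)
  · right
    have : x.1 = y.1 := x.2.eq_of_le y.2.1 fun d hd => hy d (.inl hd)
    rw [this]
    exact hy _ (.inr (h.compl hab))

/-- Ends separate pairs that are not related. -/
theorem exists_end_of_not (h : IsDeVries r) {a b : B} (hab : ¬ r a b) :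
    ∃ x : EndSpace r, a ∉ x.1 ∧ bᶜ ∉ x.1 := by
  classical
  -- A finite join equal to ⊤ would place a below a finite join of elements ≺ b, giving a ≺ b. An
  -- end containing K omits a and bᶜ: by roundness, having either would put an element and its
  -- complement in the end.
  rcases h.exists_sup_eq_top_or_exists_end (K := {y | r y aᶜ ∨ r y b}) (by
    rintro d (hd | hd)
    · obtain ⟨e, hde, he⟩ := h.interpolate hd
      exact ⟨e, .inl he, hde⟩
    · obtain ⟨e, hde, he⟩ := h.interpolate hd
      exact ⟨e, .inr he, hde⟩) with ⟨D, hD, ht⟩ | ⟨y, hy⟩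
  · refine absurd ?_ hab
    have h1 : r ((D.filter (r · b)).sup id) b := h.finset_sup _ (by simp)
    have h2 : D.sup id ≤ (D.filter (r · b)).sup id ⊔ aᶜ := Finset.sup_le fun d hd => by
      by_cases hdx : r d b
      · exact le_sup_of_le_left (Finset.le_sup (f := id) (Finset.mem_filter.2 ⟨hd, hdx⟩))
      · exact le_sup_of_le_right (h.le ((hD hd).resolve_right hdx))
    refine h.mono_left ?_ h1
    rw [ht, top_le_iff] at h2
    simpa using codisjoint_iff_compl_le_left.1 (codisjoint_iff.2 h2)
  · refine ⟨y, fun ha => ?_, fun hb => ?_⟩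
    · obtain ⟨e, he, hae⟩ := h.exists_mem_end y ha
      exact notMem_end_of_compl_mem y (hy _ (.inl (h.compl hae))) he
    · obtain ⟨e, he, hae⟩ := h.exists_mem_end y hb
      exact notMem_end_of_compl_mem y (hy _ (.inr (h.compl_left hae))) he

end IsDeVries

/-! ### The basic regular open sets of ends. -/

namespace EndSpace

variable {B : Type*} [BooleanAlgebra B] {r : B → B → Prop}

/-- The regular open set of ends that corresponds to `a`: the ends containing `aᶜ`. -/
def regularOpen (r : B → B → Prop) (a : B) : Set (EndSpace r) := zeta r aᶜ

theorem mem_regularOpen {a : B} {x : EndSpace r} : x ∈ regularOpen r a ↔ aᶜ ∈ x.1 := Iff.rfl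

theorem isOpen_regularOpen (a : B) : IsOpen (regularOpen r a) :=
  isTopologicalBasis_zeta.isOpen (mem_range_self _)

theorem regularOpen_mono {a b : B} (hab : a ≤ b) : regularOpen r a ⊆ regularOpen r b :=
  fun x hx => x.1.lower (compl_le_compl hab) hx

theorem regularOpen_inf (a b : B) :
    regularOpen r (a ⊓ b) = regularOpen r a ∩ regularOpen r b := by
  ext x
  simp [mem_regularOpen, compl_inf]

theorem regularOpen_top : regularOpen r ⊤ = univ := by
  ext x
  simp [mem_regularOpen]

theorem regularOpen_bot : regularOpen r ⊥ = ∅ := by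
  ext x
  simpa [mem_regularOpen] using IsDeVries.top_notMem_end x

theorem ne_bot_of_mem_regularOpen {a : B} {x : EndSpace r} (hx : x ∈ regularOpen r a) :
    a ≠ ⊥ := by
  rintro rfl
  simp [regularOpen_bot] at hx

theorem disjoint_regularOpen_compl (a : B) :
    Disjoint (regularOpen r a) (regularOpen r aᶜ) := by
  rw [disjoint_iff_inter_eq_empty, ← regularOpen_inf, inf_compl_self, regularOpen_bot]

theorem exists_regularOpen_of_isOpen {U : Set (EndSpace r)} (hU : IsOpen U) {x : EndSpace r}
    (hx : x ∈ U) : ∃ a, x ∈ regularOpen r a ∧ regularOpen r a ⊆ U := by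
  obtain ⟨_, ⟨a, rfl⟩, hxa, haU⟩ := isTopologicalBasis_zeta.exists_subset_of_mem_open hx hU
  exact ⟨aᶜ, by simpa [regularOpen] using hxa, by simpa [regularOpen] using haU⟩

end EndSpace

/-! ### Topology of the space of ends. -/

namespace IsDeVries

open EndSpace

variable {B : Type*} [BooleanAlgebra B] {r : B → B → Prop}

/-- For ⊥ ≠ b ≺ a, the failure of b ≺ ⊥ gives an end omitting b, and such an end must contain aᶜ. -/
theorem regularOpen_nonempty (h : IsDeVries r) {a : B} (ha : a ≠ ⊥) :
    (EndSpace.regularOpen r a).Nonempty := by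
  obtain ⟨b, hb, hba⟩ := h.exists_ne_bot ha
  have : ¬ r b ⊥ := fun hr => hb (le_bot_iff.1 (h.le hr))
  obtain ⟨x, hx, -⟩ := h.exists_end_of_not this
  exact ⟨x, (h.mem_or_compl_mem_end x hba).resolve_left hx⟩

/-- A basic neighbourhood U_c that misses U_a has c ⊓ a = ⊥ by nonemptiness, hence c ≤ aᶜ and U_c ⊆
U_{aᶜ}. -/
theorem closure_regularOpen (h : IsDeVries r) (a : B) :
    closure (EndSpace.regularOpen r a) = (EndSpace.regularOpen r aᶜ)ᶜ := by
  apply Subset.antisymm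
  · exact closure_minimal (disjoint_regularOpen_compl a).subset_compl_right
      (isOpen_regularOpen _).isClosed_compl
  · intro x hx
    rw [mem_closure_iff]
    intro U hU hxU
    obtain ⟨c, hxc, hcU⟩ := exists_regularOpen_of_isOpen hU hxU
    have hne : c ⊓ a ≠ ⊥ := fun hbot =>
      hx (regularOpen_mono (le_compl_iff_disjoint_right.2 (disjoint_iff.2 hbot)) hxc)
    obtain ⟨y, hy⟩ := h.regularOpen_nonempty hne
    rw [regularOpen_inf] at hy
    exact ⟨y, hcU hy.1, hy.2⟩

theorem interior_closure_regularOpen (h : IsDeVries r) (a : B) :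
    interior (closure (EndSpace.regularOpen r a)) = EndSpace.regularOpen r a := by
  rw [h.closure_regularOpen, interior_compl, h.closure_regularOpen, compl_compl, compl_compl]

theorem closure_regularOpen_subset_iff (h : IsDeVries r) {a b : B} :
    closure (EndSpace.regularOpen r a) ⊆ EndSpace.regularOpen r b ↔ r a b := by
  rw [h.closure_regularOpen]
  constructor
  · intro hsub
    by_contra hab
    obtain ⟨x, hxa, hxb⟩ := h.exists_end_of_not hab
    exact hxb (hsub (by simpa [mem_regularOpen] using hxa))
  · intro hab x hx
    exact (h.mem_or_compl_mem_end x hab).resolve_left (by simpa [mem_regularOpen] using hx)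

theorem closure_regularOpen_sup (h : IsDeVries r) (a b : B) :
    closure (EndSpace.regularOpen r (a ⊔ b)) =
      closure (EndSpace.regularOpen r a) ∪ closure (EndSpace.regularOpen r b) := by
  simp only [h.closure_regularOpen, compl_sup, regularOpen_inf, compl_inter]

/-- Distinct ends are incomparable by maximality. If a ∈ x is not in y, roundness gives a ≺ b ∈ x,
and then bᶜ ∈ y. -/
theorem t2Space (h : IsDeVries r) : T2Space (EndSpace r) := by
  refine ⟨fun x y hxy => ?_⟩
  have hne : ¬ x.1 ≤ y.1 := fun hle => hxy (Subtype.ext (x.2.eq_of_le y.2.1 hle))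
  obtain ⟨a, hax, hay⟩ := Set.not_subset.1 hne
  obtain ⟨b, hbx, hab⟩ := h.exists_mem_end x hax
  have hb : bᶜ ∈ y.1 := (h.mem_or_compl_mem_end y hab).resolve_left hay
  exact ⟨EndSpace.regularOpen r bᶜ, EndSpace.regularOpen r b, isOpen_regularOpen _,
    isOpen_regularOpen _, by simpa [mem_regularOpen] using hbx, hb,
    (disjoint_regularOpen_compl b).symm⟩

theorem compactSpace (h : IsDeVries r) : CompactSpace (EndSpace r) := by
  classical
  refine compactSpace_generateFrom (S := range (zeta r)) rfl fun P hP hcov => ?_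
  -- If finitely many members of K join to ⊤, the corresponding ζ(a) form a finite subcover, since
  -- an end outside all of them would contain ⊤. An end containing K lies in some ζ(a) of the cover;
  -- then a ≺ e ∈ x and eᶜ ≺ aᶜ put both e and eᶜ in x.
  rcases h.exists_sup_eq_top_or_exists_end (K := {y | ∃ a, zeta r a ∈ P ∧ r y aᶜ}) (by
    rintro d ⟨a, ha, hd⟩
    obtain ⟨e, hde, he⟩ := h.interpolate hd
    exact ⟨e, ⟨a, ha, he⟩, hde⟩) with ⟨D, hD, ht⟩ | ⟨x, hx⟩
  · have hD' : ∀ d ∈ D, ∃ a, zeta r a ∈ P ∧ r d aᶜ := fun d hd => hD hd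
    choose! f hf hrf using hD'
    refine ⟨(fun d => zeta r (f d)) '' D, image_subset_iff.2 fun d hd => hf d hd,
      D.finite_toSet.image _, eq_univ_of_forall fun x => ?_⟩
    by_contra hx
    refine top_notMem_end x (ht ▸ finset_sup_mem x.1 D fun d hd => ?_)
    refine (h.mem_or_compl_mem_end x (hrf d hd)).resolve_right fun hfd => hx ?_
    exact ⟨zeta r (f d), mem_image_of_mem _ hd, by simpa [zeta] using hfd⟩
  · obtain ⟨U, hU, hxU⟩ := hcov.symm ▸ mem_univ x
    obtain ⟨a, rfl⟩ := hP hU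
    obtain ⟨e, he, hae⟩ := h.exists_mem_end x hxU
    exact absurd he (notMem_end_of_compl_mem x (hx _ ⟨a, hU, h.compl hae⟩))

/-- The regular open sets `regularOpen r a` separate closed sets from the complements of their
open neighbourhoods. -/
theorem exists_regularOpen_between (h : IsDeVries r) {K V : Set (EndSpace r)} (hK : IsClosed K)
    (hV : IsOpen V) (hKV : K ⊆ V) :
    ∃ a, K ⊆ EndSpace.regularOpen r a ∧ closure (EndSpace.regularOpen r a) ⊆ V := by
  have := h.compactSpace
  refine hK.isCompact.induction_on
    (p := fun s => ∃ a, s ⊆ EndSpace.regularOpen r a ∧ closure (EndSpace.regularOpen r a) ⊆ V)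
    ⟨⊥, by simp, by simp [regularOpen_bot]⟩ ?_ ?_ ?_
  · rintro s t hst ⟨a, ha, haV⟩
    exact ⟨a, hst.trans ha, haV⟩
  · rintro s t ⟨a, ha, haV⟩ ⟨b, hb, hbV⟩
    refine ⟨a ⊔ b, union_subset (ha.trans (regularOpen_mono le_sup_left))
      (hb.trans (regularOpen_mono le_sup_right)), ?_⟩
    rw [h.closure_regularOpen_sup]
    exact union_subset haV hbV
  · intro x hx
    obtain ⟨c, hxc, hcV⟩ := exists_regularOpen_of_isOpen hV (hKV hx)
    -- Roundness shrinks the neighbourhood U_c of x: from cᶜ ≺ e ∈ x one gets x ∈ U_{eᶜ} and eᶜ ≺ c.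
    obtain ⟨e, he, hce⟩ := h.exists_mem_end x hxc
    refine ⟨EndSpace.regularOpen r eᶜ, mem_nhdsWithin_of_mem_nhds
      ((isOpen_regularOpen _).mem_nhds (by simpa [mem_regularOpen] using he)), eᶜ, Subset.rfl,
      (h.closure_regularOpen_subset_iff.2 (h.compl_left hce)).trans hcV⟩

/-- If a finite join is `⊤`, the corresponding regular open sets have dense union. -/
theorem eventually_exists_mem_regularOpen (h : IsDeVries r) (D : Finset B) (hD : D.sup id = ⊤) :
    ∀ᶠ x in FN.denseFilter (EndSpace r), ∃ d ∈ D, x ∈ EndSpace.regularOpen r d := by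
  have hopen : IsOpen {x | ∃ d ∈ D, x ∈ EndSpace.regularOpen r d} := by
    have : {x | ∃ d ∈ D, x ∈ EndSpace.regularOpen r d} = ⋃ d ∈ D, EndSpace.regularOpen r d := by
      ext x; simp
    rw [this]
    exact isOpen_biUnion fun d _ => isOpen_regularOpen d
  change Dense (interior _)
  rw [hopen.interior_eq, dense_iff_inter_open]
  rintro U hU ⟨x, hx⟩
  obtain ⟨c, hxc, hcU⟩ := exists_regularOpen_of_isOpen hU hx
  have : ∃ d ∈ D, c ⊓ d ≠ ⊥ := by
    by_contra! hall
    refine ne_bot_of_mem_regularOpen hxc ?_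
    rw [← inf_top_eq c, ← hD, Finset.sup_inf_distrib_left]
    exact (Finset.sup_eq_bot_iff _ _).2 hall
  obtain ⟨d, hd, hne⟩ := this
  obtain ⟨y, hy⟩ := h.regularOpen_nonempty hne
  rw [regularOpen_inf] at hy
  exact ⟨y, hcU hy.1, d, hd, hy.2⟩

end IsDeVries

/-! ## The order of a Specker `f`-algebra -/

/-- This is all that is taken from the subdirect representation; it makes every idempotent
nonnegative. -/
theorem IsFRing.sq_nonneg {S : Type*} [CommRing S] [Lattice S] (hF : IsFRing S) (s : S) :
    0 ≤ s * s := by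
  obtain ⟨ι, T, _, _, φ, _, -, hinf, -, hinj⟩ := hF
  refine inf_eq_left.1 (hinj _ _ fun i => ?_)
  rw [hinf, map_zero, map_mul]
  exact inf_eq_left.2 (mul_self_nonneg _)

theorem IsFAlgebra.isOrderedRing {A S : Type*} [CommRing A] [LinearOrder A] [CommRing S]
    [Lattice S] [Algebra A S] (h : IsFAlgebra A S) : IsOrderedRing S :=
  have := IsOrderedAddMonoid.mk (α := S) (fun a b hab c => h.add_le_add a b c hab)
    (fun a b hab c => by simpa only [add_comm c] using h.add_le_add a b c hab)
  have := ZeroLEOneClass.mk (α := S) (by simpa using h.isFRing.sq_nonneg (1 : S))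
  IsOrderedRing.of_mul_nonneg h.mul_nonneg

theorem IsFAlgebra.isOrderedModule {A S : Type*} [CommRing A] [LinearOrder A]
    [IsStrictOrderedRing A] [CommRing S] [Lattice S] [Algebra A S] (h : IsFAlgebra A S) :
    IsOrderedModule A S :=
  have := h.isOrderedRing
  { smul_le_smul_of_nonneg_left := fun a ha s t hst => by
      simpa [smul_sub] using h.smul_nonneg a (t - s) ha (sub_nonneg.2 hst)
    smul_le_smul_of_nonneg_right := fun s hs a b hab => by
      simpa [sub_smul] using h.smul_nonneg (b - a) s (sub_nonneg.2 hab) hs }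

namespace Idem

section Ring

variable {S : Type*} [CommRing S]

theorem mul_self (e : Idem S) : e.1 * e.1 = e.1 := e.2

theorem mul_compl (e : Idem S) : e.1 * (1 - e.1) = 0 := by
  rw [mul_sub, e.mul_self, mul_one, sub_self]

theorem compl_mul (e : Idem S) : (1 - e.1) * e.1 = 0 := by
  rw [mul_comm, e.mul_compl]

theorem eq_bot_iff_val (e : Idem S) : e = ⊥ ↔ e.1 = 0 := Subtype.ext_iff

end Ring

section Order

variable {S : Type*} [CommRing S] [Lattice S]

theorem nonneg (hF : IsFRing S) (e : Idem S) : 0 ≤ e.1 := by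
  simpa only [e.mul_self] using hF.sq_nonneg e.1

theorem one_sub_nonneg (hF : IsFRing S) (e : Idem S) : 0 ≤ 1 - e.1 := nonneg hF eᶜ

variable [IsOrderedRing S]

theorem le_one (hF : IsFRing S) (e : Idem S) : e.1 ≤ 1 := sub_nonneg.1 (one_sub_nonneg hF e)

theorem val_mono (hF : IsFRing S) {e k : Idem S} (hek : e ≤ k) : e.1 ≤ k.1 := by
  have h := mul_nonneg (nonneg hF k) (one_sub_nonneg hF e)
  rw [mul_sub, mul_one, mul_comm, (le_iff e k).1 hek] at h
  exact sub_nonneg.1 h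

theorem le_of_val_le (hF : IsFRing S) {e k : Idem S} (hek : e.1 ≤ k.1) : e ≤ k := by
  rw [le_iff]
  have h1 := mul_le_mul_of_nonneg_right hek (one_sub_nonneg hF k)
  rw [k.mul_compl] at h1
  have h2 := mul_nonneg (nonneg hF e) (one_sub_nonneg hF k)
  have h3 := le_antisymm h1 h2
  rw [mul_sub, mul_one, sub_eq_zero] at h3
  exact h3.symm

/-- Inequalities may be checked on an idempotent and its complement. -/
theorem le_of_mul_le (e : Idem S) {s t : S} (h₁ : e.1 * s ≤ e.1 * t)
    (h₂ : (1 - e.1) * s ≤ (1 - e.1) * t) : s ≤ t := by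
  have := add_le_add h₁ h₂
  rwa [← add_mul, ← add_mul, add_sub_cancel, one_mul, one_mul] at this

theorem mul_inf (hF : IsFRing S) (e : Idem S) (s t : S) :
    e.1 * (s ⊓ t) = e.1 * s ⊓ e.1 * t := by
  have he := nonneg hF e
  have he' := one_sub_nonneg hF e
  refine le_antisymm (le_inf (mul_le_mul_of_nonneg_left inf_le_left he)
    (mul_le_mul_of_nonneg_left inf_le_right he)) ?_
  have key : ∀ u v : S, e.1 * (e.1 * u ⊓ v) ≤ e.1 * u := fun u v => by
    have := mul_le_mul_of_nonneg_left (inf_le_left : e.1 * u ⊓ v ≤ _) he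
    rwa [← mul_assoc, e.mul_self] at this
  set w := e.1 * s ⊓ e.1 * t with hw
  -- Patching w on e with s ⊓ t on 1 - e gives a lower bound of s and t; multiplying by e yields e w
  -- ≤ e (s ⊓ t). Finally w ≤ e w, since (1 - e) w ≤ 0.
  have h1 : e.1 * w + (1 - e.1) * (s ⊓ t) ≤ s ⊓ t := by
    refine le_inf ?_ ?_
    · calc _ ≤ e.1 * s + (1 - e.1) * s :=
            add_le_add (key s _) (mul_le_mul_of_nonneg_left inf_le_left he')
        _ = s := by ring
    · calc _ ≤ e.1 * t + (1 - e.1) * t :=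
            add_le_add (by rw [hw, inf_comm]; exact key t _)
              (mul_le_mul_of_nonneg_left inf_le_right he')
        _ = t := by ring
  have h2 : e.1 * w ≤ e.1 * (s ⊓ t) := by
    have := mul_le_mul_of_nonneg_left h1 he
    rwa [mul_add, ← mul_assoc, ← mul_assoc, e.mul_self, e.mul_compl, zero_mul, add_zero] at this
  refine le_trans (le_of_mul_le e ?_ ?_) h2
  · rw [← mul_assoc, e.mul_self]
  · have := mul_le_mul_of_nonneg_left (inf_le_left : w ≤ e.1 * s) he'
    rw [← mul_assoc, e.compl_mul, zero_mul] at this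
    rwa [← mul_assoc, e.compl_mul, zero_mul]

theorem mul_sup (hF : IsFRing S) (e : Idem S) (s t : S) :
    e.1 * (s ⊔ t) = e.1 * s ⊔ e.1 * t := by
  have := mul_inf hF e (-s) (-t)
  rw [← neg_sup, mul_neg, mul_neg, mul_neg, ← neg_sup] at this
  exact neg_injective this

/-- Inequalities may be checked locally. -/
theorem mul_le_mul_of_le_sup (hF : IsFRing S) (D : Finset (Idem S)) {x : Idem S}
    (hx : x ≤ D.sup id) {s t : S} (h : ∀ e ∈ D, e.1 * s ≤ e.1 * t) : x.1 * s ≤ x.1 * t := by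
  classical
  have key : (D.sup id).1 * s ≤ (D.sup id).1 * t := by
    clear hx
    induction D using Finset.induction_on with
    | empty => simp [val_bot]
    | insert a E _ ih =>
      rw [Finset.sup_insert]
      have h1 := h a (Finset.mem_insert_self a E)
      have h2 := mul_le_mul_of_nonneg_left
        (ih fun e he => h e (Finset.mem_insert_of_mem he)) (one_sub_nonneg hF a)
      have h3 := add_le_add h1 h2
      rw [val_sup]
      convert h3 using 1 <;> simp only [id] <;> ring
  have := mul_le_mul_of_nonneg_left key (nonneg hF x)
  rwa [← mul_assoc, ← mul_assoc, (le_iff _ _).1 hx] at this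

theorem le_of_forall_mul_le (hF : IsFRing S) (D : Finset (Idem S)) (hD : D.sup id = ⊤)
    {s t : S} (h : ∀ e ∈ D, e.1 * s ≤ e.1 * t) : s ≤ t := by
  simpa [val_top] using mul_le_mul_of_le_sup hF D (x := ⊤) hD.ge h

end Order

section Scalar

variable {A S : Type*} [CommRing A] [LinearOrder A] [IsStrictOrderedRing A] [CommRing S]
  [Lattice S] [Algebra A S] [IsOrderedRing S] [IsOrderedModule A S] [Module.IsTorsionFree A S]

theorem le_of_smul_le_smul (hF : IsFRing S) {e : Idem S} (he : e.1 ≠ 0) {a b : A}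
    (hab : a • e.1 ≤ b • e.1) : a ≤ b := by
  by_contra! hba
  have h1 : b • e.1 ≤ a • e.1 := smul_le_smul_of_nonneg_right hba.le (nonneg hF e)
  have h2 : (a - b) • e.1 = 0 := by rw [sub_smul, le_antisymm hab h1, sub_self]
  rcases smul_eq_zero.1 h2 with h3 | h3
  · exact hba.ne' (sub_eq_zero.1 h3)
  · exact he h3

end Scalar

end Idem

/-! ## Local constancy and thresholds -/

section Cover

variable {A S : Type*} [CommRing A] [CommRing S] [Algebra A S]

/-- The idempotents in `D` cover `1`, and on each of them `s` agrees with a scalar, given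
by `v`. -/
structure IsConstCover (s : S) (D : Finset (Idem S)) (v : Idem S → A) : Prop where
  sup_eq_top : D.sup id = ⊤
  mul_eq : ∀ e ∈ D, e.1 * s = v e • e.1

theorem IsSpecker.exists_isConstCover (h : IsSpecker A S) (s : S) :
    ∃ (D : Finset (Idem S)) (v : Idem S → A), IsConstCover s D v := by
  classical
  suffices h' : ∃ D : Finset (Idem S), D.sup id = ⊤ ∧ ∀ e ∈ D, ∃ a : A, e.1 * s = a • e.1 by
    obtain ⟨D, hD, hv⟩ := h'
    choose! v hv using hv
    exact ⟨D, v, hD, hv⟩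
  obtain ⟨B, -, hB⟩ := h
  have hs : s ∈ Algebra.adjoin A {s : S | ∃ e ∈ B, e.1 = s} := hB ▸ Algebra.mem_top
  -- The pairwise meets of two covers form a cover, on whose members both elements are scalar.
  have key : ∀ (D E : Finset (Idem S)) (p : Idem S → Prop), D.sup id = ⊤ → E.sup id = ⊤ →
      (∀ d ∈ D, ∀ e ∈ E, p (d ⊓ e)) → ∃ D : Finset (Idem S), D.sup id = ⊤ ∧ ∀ e ∈ D, p e := by
    intro D E p hD hE hp
    refine ⟨(D ×ˢ E).image fun x => x.1 ⊓ x.2, ?_, ?_⟩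
    · have := Finset.sup_inf_sup D E id id
      rw [hD, hE, inf_top_eq] at this
      rw [Finset.sup_image]
      exact this.symm
    · intro x hx
      obtain ⟨⟨d, e⟩, hde, rfl⟩ := Finset.mem_image.1 hx
      rw [Finset.mem_product] at hde
      exact hp d hde.1 e hde.2
  induction hs using Algebra.adjoin_induction with
  | mem x hx =>
    obtain ⟨e, -, rfl⟩ := hx
    refine ⟨{e, eᶜ}, by simp, ?_⟩
    simp only [Finset.mem_insert, Finset.mem_singleton, forall_eq_or_imp, forall_eq]
    refine ⟨⟨1, by rw [e.mul_self, one_smul]⟩, 0, ?_⟩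
    rw [Idem.val_compl, mul_comm, e.mul_compl, zero_smul]
  | algebraMap a =>
    exact ⟨{⊤}, by simp, fun e _ => ⟨a, by rw [mul_comm, Algebra.smul_def]⟩⟩
  | add x y _ _ hx hy =>
    obtain ⟨D, hD, hx⟩ := hx
    obtain ⟨E, hE, hy⟩ := hy
    refine key D E _ hD hE fun d hd e he => ?_
    obtain ⟨a, ha⟩ := hx d hd
    obtain ⟨b, hb⟩ := hy e he
    refine ⟨a + b, ?_⟩
    rw [Idem.val_inf]
    linear_combination (exp := 1) e.1 * ha + d.1 * hb + (by
      simp only [Algebra.smul_def, map_add]; ring :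
        e.1 * a • d.1 + d.1 * b • e.1 = (a + b) • (d.1 * e.1))
  | mul x y _ _ hx hy =>
    obtain ⟨D, hD, hx⟩ := hx
    obtain ⟨E, hE, hy⟩ := hy
    refine key D E _ hD hE fun d hd e he => ?_
    obtain ⟨a, ha⟩ := hx d hd
    obtain ⟨b, hb⟩ := hy e he
    refine ⟨a * b, ?_⟩
    rw [Idem.val_inf, mul_mul_mul_comm, ha, hb, smul_mul_smul_comm]

theorem mul_algebraMap_eq_smul (a : A) (s : S) : s * algebraMap A S a = a • s := by
  rw [mul_comm, Algebra.smul_def]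

end Cover

section Threshold

variable {A S : Type*} [CommRing A] [LinearOrder A] [CommRing S] [Lattice S] [Algebra A S]

/-- The idempotent `c` is the truth value of `a ≤ s`. -/
def IsThreshold (s : S) (a : A) (c : Idem S) : Prop :=
  a • c.1 ≤ c.1 * s ∧ ∃ b < a, (1 - c.1) * s ≤ b • (1 - c.1)

variable [IsStrictOrderedRing A] [IsOrderedRing S] [IsOrderedModule A S]

theorem IsConstCover.isThreshold (hF : IsFRing S) {s : S} {D : Finset (Idem S)}
    {v : Idem S → A} (h : IsConstCover s D v) (a : A) :
    IsThreshold s a ((D.filter (a ≤ v ·)).sup id) := by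
  classical
  set c := (D.filter (a ≤ v ·)).sup id with hc
  refine ⟨?_, ?_⟩
  · rw [← mul_algebraMap_eq_smul]
    refine Idem.mul_le_mul_of_le_sup hF _ hc.le fun e he => ?_
    rw [Finset.mem_filter] at he
    rw [h.mul_eq e he.1, mul_algebraMap_eq_smul]
    exact smul_le_smul_of_nonneg_right he.2 (Idem.nonneg hF e)
  -- Take b to be the largest value below a; if there is none, any b < a serves, such as a - 1. The
  -- gap a - b > 0 is the scalar cancelled in `of_isThreshold`.
  · obtain ⟨b, hba, hb⟩ : ∃ b < a, ∀ e ∈ D, v e < a → v e ≤ b := by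
      by_cases hne : ((D.image v).filter (· < a)).Nonempty
      · refine ⟨_, (Finset.mem_filter.1 (Finset.max'_mem _ hne)).2, fun e he hlt => ?_⟩
        exact Finset.le_max' _ _ (Finset.mem_filter.2 ⟨Finset.mem_image_of_mem v he, hlt⟩)
      · refine ⟨a - 1, sub_one_lt a, fun e he hlt => absurd ?_ hne⟩
        exact ⟨v e, Finset.mem_filter.2 ⟨Finset.mem_image_of_mem v he, hlt⟩⟩
    refine ⟨b, hba, ?_⟩
    rw [← mul_algebraMap_eq_smul, ← Idem.val_compl]
    refine Idem.mul_le_mul_of_le_sup hF (D.filter (v · < a)) ?_ fun e he => ?_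
    · have : c ⊔ (D.filter (v · < a)).sup id = ⊤ := by
        rw [hc, ← Finset.sup_union, ← h.sup_eq_top]
        congr 1
        ext e
        have := le_or_gt a (v e)
        simp only [Finset.mem_union, Finset.mem_filter]
        tauto
      exact codisjoint_iff_compl_le_right.1 (codisjoint_iff.2 this)
    · rw [Finset.mem_filter] at he
      rw [h.mul_eq e he.1, mul_algebraMap_eq_smul]
      exact smul_le_smul_of_nonneg_right (hb e he.1 he.2) (Idem.nonneg hF e)

theorem IsConstCover.exists_le (hF : IsFRing S) {s : S} {D : Finset (Idem S)}
    {v : Idem S → A} (h : IsConstCover s D v) : ∃ m : A, algebraMap A S m ≤ s := by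
  classical
  obtain ⟨m, hm⟩ := (D.image v).finite_toSet.bddBelow
  refine ⟨m, Idem.le_of_forall_mul_le hF D h.sup_eq_top fun e he => ?_⟩
  rw [h.mul_eq e he, mul_algebraMap_eq_smul]
  exact smul_le_smul_of_nonneg_right (hm (Finset.mem_coe.2 (Finset.mem_image_of_mem v he)))
    (Idem.nonneg hF e)

/-- An idempotent on which `s` has the value `a` lies below the threshold idempotent. -/
theorem IsThreshold.le [Module.IsTorsionFree A S] (hF : IsFRing S) {s : S} {a : A} {c e : Idem S}
    (hc : IsThreshold s a c) (he : a • e.1 ≤ e.1 * s) : e ≤ c := by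
  obtain ⟨-, b, hba, hb⟩ := hc
  by_contra hec
  -- On the nonzero idempotent e ⊓ cᶜ one would have a ≤ s ≤ b, against b < a.
  have hne : (e ⊓ cᶜ).1 ≠ 0 := fun h0 =>
    hec (disjoint_compl_right_iff.1 (disjoint_iff.2 ((Idem.eq_bot_iff_val _).2 h0)))
  refine hba.not_ge (Idem.le_of_smul_le_smul hF hne ?_)
  have h1 := mul_le_mul_of_nonneg_left he (Idem.one_sub_nonneg hF c)
  have h2 := mul_le_mul_of_nonneg_left hb (Idem.nonneg hF e)
  rw [Idem.val_inf, Idem.val_compl]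
  calc a • (e.1 * (1 - c.1)) = (1 - c.1) * a • e.1 := by rw [mul_smul_comm, mul_comm]
    _ ≤ (1 - c.1) * (e.1 * s) := h1
    _ = e.1 * ((1 - c.1) * s) := by ring
    _ ≤ e.1 * b • (1 - c.1) := h2
    _ = _ := by rw [mul_smul_comm]

end Threshold

/-! ## Proximities and thresholds -/

namespace IsProximity

variable {A S : Type*} [CommRing A] [LinearOrder A] [CommRing S] [Lattice S] [Algebra A S]
  {r : S → S → Prop}

theorem mono_left (h : IsProximity A r) {s t u : S} (hst : s ≤ t) (htu : r t u) : r s u :=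
  h.le_trans_le hst htu le_rfl

theorem mono_right (h : IsProximity A r) {s t u : S} (hst : r s t) (htu : t ≤ u) : r s u :=
  h.le_trans_le le_rfl hst htu

theorem one_sub (h : IsProximity A r) {s t : S} (hst : r s t) : r (1 - t) (1 - s) := by
  simpa [sub_eq_add_neg] using h.add h.one_one (h.neg hst)

theorem const [IsStrictOrderedRing A] (h : IsProximity A r) (a : A) :
    r (algebraMap A S a) (algebraMap A S a) := by
  rw [Algebra.algebraMap_eq_smul_one]
  rcases lt_trichotomy a 0 with ha | rfl | ha
  · simpa using h.neg (h.smul (neg_pos.2 ha) h.one_one)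
  · simpa using h.zero_zero
  · exact h.smul ha h.one_one

variable [IsOrderedRing S]

theorem sup (h : IsProximity A r) {s t u : S} (hsu : r s u) (htu : r t u) : r (s ⊔ t) u := by
  have := h.neg (h.inf (h.neg hsu) (h.neg htu))
  rwa [← neg_sup, neg_neg, neg_neg] at this

variable [IsStrictOrderedRing A]

variable [IsOrderedModule A S]

/-- A multiple of an idempotent can be cancelled on the left if the right side is supported on
an idempotent. -/
theorem cancel (h : IsProximity A r) (hF : IsFRing S) {c d : Idem S} {α : A} (hα : 0 < α) {y : S}
    (hcy : r (α • c.1) y) (hy : (1 - d.1) * y ≤ 0) : r c.1 d.1 := by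
  -- Since α c ≤ α ≺ α, also α c ≺ y ⊓ α. This meet is at most α on d and at most 0 off d, hence at
  -- most α d, and α cancels.
  refine h.of_smul hα (h.mono_right (h.inf hcy (h.mono_left ?_ (h.const α))) ?_)
  · rw [Algebra.algebraMap_eq_smul_one]
    exact smul_le_smul_of_nonneg_left (Idem.le_one hF c) hα.le
  · refine Idem.le_of_mul_le d ?_ ?_
    · rw [mul_smul_comm, d.mul_self, ← mul_algebraMap_eq_smul]
      exact mul_le_mul_of_nonneg_left inf_le_right (Idem.nonneg hF d)
    · rw [mul_smul_comm, d.compl_mul, smul_zero]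
      exact (mul_le_mul_of_nonneg_left inf_le_left (Idem.one_sub_nonneg hF d)).trans hy

/-- Let b < a bound t off d. Truncation gives (s - b) ⊔ 0 ≺ (t - b) ⊔ 0, where the left side
dominates (a - b) c and the right side vanishes off d; then `cancel` applies. -/
theorem of_isThreshold (h : IsProximity A r) (hF : IsFRing S) {s t : S} (hst : r s t) {a : A}
    {c d : Idem S} (hc : IsThreshold s a c) (hd : IsThreshold t a d) : r c.1 d.1 := by
  obtain ⟨b, hba, hb⟩ := hd.2
  set β := algebraMap A S b with hβ
  have h1 : r (s - β) (t - β) := by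
    simpa [sub_eq_add_neg] using h.add hst (h.neg (h.const b))
  have h2 : r ((s - β) ⊔ 0) ((t - β) ⊔ 0) :=
    h.sup (h.mono_right h1 le_sup_left) (h.mono_right h.zero_zero le_sup_right)
  refine h.cancel hF (sub_pos.2 hba) (h.mono_left ?_ h2) ?_
  · calc (a - b) • c.1 = a • c.1 - c.1 * β := by rw [sub_smul, hβ, mul_algebraMap_eq_smul]
      _ ≤ c.1 * s - c.1 * β := sub_le_sub_right hc.1 _
      _ = c.1 * (s - β) := by ring
      _ ≤ c.1 * ((s - β) ⊔ 0) := mul_le_mul_of_nonneg_left le_sup_left (Idem.nonneg hF c)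
      _ ≤ 1 * ((s - β) ⊔ 0) := mul_le_mul_of_nonneg_right (Idem.le_one hF c) le_sup_right
      _ = _ := one_mul _
  · rw [← Idem.val_compl, Idem.mul_sup hF, mul_zero, Idem.val_compl]
    refine sup_le ?_ le_rfl
    rw [mul_sub, sub_nonpos, hβ, mul_algebraMap_eq_smul]
    exact hb

theorem restrict_isDeVries [Module.IsTorsionFree A S] (h : IsProximity A r) (hF : IsFRing S)
    (hcov : ∀ s : S, ∃ (D : Finset (Idem S)) (v : Idem S → A), IsConstCover s D v) :
    IsDeVries (Idem.restrict r) where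
  bot := h.zero_zero
  le hab := Idem.le_of_val_le hF (h.le hab)
  le_trans_le hab hbc hcd :=
    h.le_trans_le (Idem.val_mono hF hab) hbc (Idem.val_mono hF hcd)
  inf {a b c} hab hac := by
    refine h.mono_right (h.inf hab hac) (Idem.le_of_mul_le b ?_ ?_)
    · rw [Idem.val_inf, ← mul_assoc, b.mul_self]
      exact mul_le_mul_of_nonneg_left inf_le_right (Idem.nonneg hF b)
    · rw [Idem.val_inf, ← mul_assoc, mul_comm _ b.1, b.mul_compl, zero_mul]
      refine (mul_le_mul_of_nonneg_left inf_le_left (Idem.one_sub_nonneg hF b)).trans ?_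
      rw [b.compl_mul]
  compl hab := h.one_sub hab
  interpolate {a b} hab := by
    obtain ⟨s, has, hsb⟩ := h.interpolate hab
    obtain ⟨D, v, hD⟩ := hcov s
    -- The interpolating idempotent is the part where s reaches 1. Then c ≤ s ≺ b, while off c one
    -- has s ≤ β < 1.
    obtain ⟨c, hc, β, hβ, hcβ⟩ : ∃ c, IsThreshold s (1 : A) c := ⟨_, hD.isThreshold hF 1⟩
    rw [one_smul] at hc
    have hs0 : 0 ≤ s := (Idem.nonneg hF a).trans (h.le has)
    have hs1 : s ≤ 1 := (h.le hsb).trans (Idem.le_one hF b)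
    refine ⟨c, ?_, h.mono_left (hc.trans ?_) hsb⟩
    -- The gap gives (1 - β)(1 - c) ≤ 1 - s ≺ 1 - a, and 1 - β cancels.
    · have h1 : r (1 - c.1) (1 - a.1) := by
        refine h.cancel hF (c := cᶜ) (d := aᶜ) (sub_pos.2 hβ) (h.mono_left ?_ (h.one_sub has)) ?_
        · rw [Idem.val_compl, sub_smul, one_smul]
          have h2 : c.1 * s ≤ c.1 * 1 := mul_le_mul_of_nonneg_left hs1 (Idem.nonneg hF c)
          have h3 : s = c.1 * s + (1 - c.1) * s := by ring
          have h4 := add_le_add h2 hcβ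
          rw [← h3, mul_one] at h4
          calc (1 - c.1) - β • (1 - c.1) = 1 - (c.1 + β • (1 - c.1)) := by abel
            _ ≤ 1 - s := sub_le_sub_left h4 _
        · rw [Idem.val_compl, sub_sub_cancel, a.mul_compl]
      simpa [Idem.restrict] using h.one_sub h1
    · simpa using mul_le_mul_of_nonneg_right (Idem.le_one hF c) hs0
  exists_ne_bot {a} ha := by
    have ha0 : a.1 ≠ 0 := fun h0 => ha ((Idem.eq_bot_iff_val _).2 h0)
    obtain ⟨t, ht, hta⟩ := h.exists_pos (lt_of_le_of_ne (Idem.nonneg hF a) ha0.symm)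
    obtain ⟨D, v, hD⟩ := hcov t
    -- A cover member e on which t is nonzero has value v e > 0, so (v e) e ≤ t ≺ a, and v e
    -- cancels.
    obtain ⟨e, he, hne⟩ : ∃ e ∈ D, e.1 * t ≠ 0 := by
      by_contra! hall
      refine ht.not_ge (Idem.le_of_forall_mul_le hF D hD.sup_eq_top fun e he => ?_)
      rw [hall e he, mul_zero]
    rw [hD.mul_eq e he] at hne
    have he0 : e.1 ≠ 0 := fun h0 => hne (by rw [h0, smul_zero])
    have hv0 : v e ≠ 0 := fun h0 => hne (by rw [h0, zero_smul])
    have hv : 0 ≤ v e := by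
      refine Idem.le_of_smul_le_smul hF he0 ?_
      rw [zero_smul, ← hD.mul_eq e he]
      exact mul_nonneg (Idem.nonneg hF e) ht.le
    refine ⟨e, fun h0 => he0 ((Idem.eq_bot_iff_val _).1 h0),
      h.cancel hF (lt_of_le_of_ne hv hv0.symm) (h.mono_left ?_ hta) ?_⟩
    · rw [← hD.mul_eq e he]
      simpa using mul_le_mul_of_nonneg_right (Idem.le_one hF e) ht.le
    · rw [a.compl_mul]

/-- A proximity is determined by its restriction to the threshold idempotents. -/
theorem iff_forall_isThreshold [Module.IsTorsionFree A S] (h : IsProximity A r) (hF : IsFRing S)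
    (hcov : ∀ s : S, ∃ (D : Finset (Idem S)) (v : Idem S → A), IsConstCover s D v) {s t : S} :
    r s t ↔ ∀ (a : A) (c d : Idem S), IsThreshold s a c → IsThreshold t a d → r c.1 d.1 := by
  classical
  refine ⟨fun hst a c d hc hd => h.of_isThreshold hF hst hc hd, fun H => ?_⟩
  obtain ⟨D, v, hD⟩ := hcov s
  obtain ⟨E, w, hE⟩ := hcov t
  obtain ⟨m₁, hm₁⟩ := hD.exists_le hF
  obtain ⟨m₂, hm₂⟩ := hE.exists_le hF
  set m := m₁ ⊓ m₂ with hm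
  have hmono : ∀ a b : A, a ≤ b → algebraMap A S a ≤ algebraMap A S b := fun a b hab => by
    simpa [Algebra.algebraMap_eq_smul_one] using
      smul_le_smul_of_nonneg_right hab (zero_le_one' S)
  have hms : algebraMap A S m ≤ s := (hmono _ _ inf_le_left).trans hm₁
  have hmt : algebraMap A S m ≤ t := (hmono _ _ inf_le_right).trans hm₂
  -- Take u = m + (v e - m) c with c, d the thresholds of s and t at v e: it equals s on e, and u ≺
  -- m + (v e - m) d ≤ t. The lower bound m makes the coefficients nonnegative. The join of these u
  -- is ≺ t and dominates s.
  have step : ∀ e ∈ D, ∃ u, r u t ∧ e.1 * s ≤ e.1 * u := by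
    intro e he
    -- On a zero idempotent the value v e is arbitrary and need not be at least m.
    by_cases he0 : e.1 = 0
    · exact ⟨_, h.mono_right (h.const m) hmt, by simp [he0]⟩
    have hma : m ≤ v e := by
      refine Idem.le_of_smul_le_smul hF he0 ?_
      rw [← hD.mul_eq e he, ← mul_algebraMap_eq_smul]
      exact mul_le_mul_of_nonneg_left hms (Idem.nonneg hF e)
    set c := (D.filter (v e ≤ v ·)).sup id
    have hc : IsThreshold s (v e) c := hD.isThreshold hF _
    obtain ⟨d, hd⟩ : ∃ d, IsThreshold t (v e) d := ⟨_, hE.isThreshold hF _⟩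
    have hcd := H _ _ _ hc hd
    have hec : e ≤ c := hc.le hF (hD.mul_eq e he).ge
    have hsm : r ((v e - m) • c.1) ((v e - m) • d.1) := by
      rcases hma.eq_or_lt with heq | hlt
      · simpa [← heq] using h.zero_zero
      · exact h.smul (sub_pos.2 hlt) hcd
    refine ⟨algebraMap A S m + (v e - m) • c.1,
      h.mono_right (h.add (h.const m) hsm) (Idem.le_of_mul_le d ?_ ?_), ?_⟩
    · rw [mul_add, mul_algebraMap_eq_smul, mul_smul_comm, d.mul_self, ← add_smul,
        add_sub_cancel]
      exact hd.1
    · rw [mul_add, mul_smul_comm, d.compl_mul, smul_zero, add_zero]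
      exact mul_le_mul_of_nonneg_left hmt (Idem.one_sub_nonneg hF d)
    · rw [hD.mul_eq e he, mul_add, mul_algebraMap_eq_smul, mul_smul_comm,
        (Idem.le_iff _ _).1 hec, ← add_smul, add_sub_cancel]
  choose! u hu hsu using step
  have hfin : ∀ F : Finset (Idem S), F ⊆ D → ∃ w, r w t ∧ ∀ e ∈ F, e.1 * s ≤ e.1 * w := by
    intro F
    induction F using Finset.induction_on with
    | empty => exact fun _ => ⟨_, h.mono_right (h.const m) hmt, by simp⟩
    | insert a F _ ih =>
      intro hF'
      rw [Finset.insert_subset_iff] at hF'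
      obtain ⟨w, hw, hws⟩ := ih hF'.2
      refine ⟨u a ⊔ w, h.sup (hu a hF'.1) hw, fun e he => ?_⟩
      rcases Finset.mem_insert.1 he with rfl | he
      · exact (hsu e hF'.1).trans (mul_le_mul_of_nonneg_left le_sup_left (Idem.nonneg hF e))
      · exact (hws e he).trans (mul_le_mul_of_nonneg_left le_sup_right (Idem.nonneg hF e))
  obtain ⟨w, hw, hws⟩ := hfin D Finset.Subset.rfl
  exact h.mono_left (Idem.le_of_forall_mul_le hF D hD.sup_eq_top hws) hw

end IsProximity

/-! ## The representation by normal functions -/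

namespace FN

variable {X A : Type*} [TopologicalSpace X] [LinearOrder A]

theorem normalize_apply_of_eventually {f : X → A} (hf : (range f).Finite) {x : X}
    (hx : ∀ᶠ y in 𝓝 x, f y = f x) : normalize f hf x = f x := by
  have key : ∀ a, a ≤ normalize f hf x ↔ a ≤ f x := fun a => by
    rw [le_normalize_iff]
    constructor
    · intro hxa
      obtain ⟨y, hy, hya⟩ := mem_closure_iff_nhds.1 (interior_subset hxa) _ hx
      exact (mem_Ici.1 hya).trans_eq hy
    · intro ha
      refine interior_mono subset_closure (mem_interior_iff_mem_nhds.2 ?_)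
      filter_upwards [hx] with y hy
      exact ha.trans_eq hy.symm
  exact le_antisymm ((key _).1 le_rfl) ((key _).2 le_rfl)

theorem subset_closure_of_eventually {U V : Set X} (hU : IsOpen U)
    (h : ∀ᶠ x in denseFilter X, x ∈ U → x ∈ V) : U ⊆ closure V :=
  (Dense.open_subset_closure_inter (mem_denseFilter.1 h) hU).trans <| closure_mono fun x hx => by
    have hx2 : x ∈ {x | x ∈ U → x ∈ V} := interior_subset hx.2
    exact hx2 hx.1

theorem sup_ev (f g : FN X A) : ∀ᶠ x in denseFilter X, (f ⊔ g) x = f x ⊔ g x :=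
  lift₂_eventuallyEq (· ⊔ ·) f g

/-- Normalizing the join enlarges its level sets only within the closure of the union, which is the
union of the closures. -/
theorem prox_sup {f g k : FN X A} (hf : prox f k) (hg : prox g k) : prox (f ⊔ g) k := by
  intro a
  have h : (f ⊔ g : FN X A) ⁻¹' Ici a ⊆ closure (f ⁻¹' Ici a ∪ g ⁻¹' Ici a) :=
    subset_closure_of_eventually ((f ⊔ g).isOpen_preimage a) <| by
      filter_upwards [sup_ev f g] with x hx hxa
      rw [mem_preimage, hx, mem_Ici, le_sup_iff] at hxa
      exact hxa
  refine (closure_minimal h isClosed_closure).trans ?_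
  rw [closure_union]
  exact union_subset (hf a) (hg a)

end FN

/-! ### Local values of algebra elements at ends. -/

namespace EndSpace

variable {A S : Type*} [CommRing A] [CommRing S] [Algebra A S] {R : Idem S → Idem S → Prop}

/-- The element `s` has the value `a` on a basic neighbourhood of the end `x`. -/
def HasValue (x : EndSpace R) (s : S) (a : A) : Prop :=
  ∃ e, x ∈ regularOpen R e ∧ e.1 * s = a • e.1

theorem HasValue.exists_common {x : EndSpace R} {s t : S} {a b : A} (hs : HasValue x s a)
    (ht : HasValue x t b) :
    ∃ e, x ∈ regularOpen R e ∧ e.1 * s = a • e.1 ∧ e.1 * t = b • e.1 := by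
  obtain ⟨e, he, hes⟩ := hs
  obtain ⟨k, hk, hkt⟩ := ht
  refine ⟨e ⊓ k, by rw [regularOpen_inf]; exact ⟨he, hk⟩, ?_, ?_⟩
  · rw [Idem.val_inf, mul_right_comm, hes, smul_mul_assoc]
  · rw [Idem.val_inf, mul_assoc, hkt, mul_smul_comm]

theorem HasValue.unique [IsDomain A] [Module.IsTorsionFree A S] {x : EndSpace R} {s : S}
    {a b : A} (ha : HasValue x s a) (hb : HasValue x s b) : a = b := by
  obtain ⟨e, he, hea, heb⟩ := ha.exists_common hb
  have h0 : (a - b) • e.1 = 0 := by rw [sub_smul, ← hea, ← heb, sub_self]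
  rcases smul_eq_zero.1 h0 with h1 | h1
  · exact sub_eq_zero.1 h1
  · exact absurd ((Idem.eq_bot_iff_val e).2 h1) (ne_bot_of_mem_regularOpen he)

theorem HasValue.add {x : EndSpace R} {s t : S} {a b : A} (hs : HasValue x s a)
    (ht : HasValue x t b) : HasValue x (s + t) (a + b) := by
  obtain ⟨e, he, hes, het⟩ := hs.exists_common ht
  exact ⟨e, he, by rw [mul_add, hes, het, add_smul]⟩

theorem HasValue.mul {x : EndSpace R} {s t : S} {a b : A} (hs : HasValue x s a)
    (ht : HasValue x t b) : HasValue x (s * t) (a * b) := by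
  obtain ⟨e, he, hes, het⟩ := hs.exists_common ht
  exact ⟨e, he, by rw [← mul_assoc, hes, smul_mul_assoc, het, smul_smul]⟩

theorem hasValue_algebraMap (x : EndSpace R) (a : A) : HasValue x (algebraMap A S a) a :=
  ⟨⊤, by simp [regularOpen_top], mul_algebraMap_eq_smul a _⟩

theorem eventually_hasValue {x : EndSpace R} {s : S} {a : A} (h : HasValue x s a) :
    ∀ᶠ y in 𝓝 x, HasValue y s a := by
  obtain ⟨e, he, hes⟩ := h
  filter_upwards [(isOpen_regularOpen e).mem_nhds he] with y hy
  exact ⟨e, hy, hes⟩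

/-- The value of `s` at `x`, if there is one. -/
noncomputable def localValue (A : Type*) [CommRing A] [Algebra A S] (s : S) (x : EndSpace R) : A :=
  open Classical in if h : ∃ a : A, HasValue x s a then h.choose else 0

theorem HasValue.localValue_eq [IsDomain A] [Module.IsTorsionFree A S] {x : EndSpace R} {s : S}
    {a : A} (h : HasValue x s a) : localValue A s x = a := by
  have h' : ∃ a : A, HasValue x s a := ⟨a, h⟩
  rw [localValue, dif_pos h']
  exact h'.choose_spec.unique h

theorem finite_range_localValue [IsDomain A] [Module.IsTorsionFree A S] {s : S}
    (hs : ∃ (D : Finset (Idem S)) (v : Idem S → A), IsConstCover s D v) :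
    (range (localValue A s : EndSpace R → A)).Finite := by
  obtain ⟨D, v, hD⟩ := hs
  -- The extra 0 is the default of `localValue` where s has no value. A genuine value on e is v d
  -- for any d in D meeting e.
  refine ((D.finite_toSet.image v).insert 0).subset ?_
  rintro _ ⟨x, rfl⟩
  by_cases h : ∃ a : A, HasValue x s a
  · right
    obtain ⟨a, ha⟩ := h
    rw [ha.localValue_eq]
    obtain ⟨e, he, hes⟩ := ha
    have : ∃ d ∈ D, e ⊓ d ≠ ⊥ := by
      by_contra! hall
      refine ne_bot_of_mem_regularOpen he ?_
      rw [← inf_top_eq e, ← hD.sup_eq_top, Finset.sup_inf_distrib_left]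
      exact (Finset.sup_eq_bot_iff _ _).2 hall
    obtain ⟨d, hd, hne⟩ := this
    refine ⟨d, hd, ?_⟩
    have h0 : (v d - a) • (e ⊓ d).1 = 0 := by
      rw [Idem.val_inf, sub_smul, ← mul_smul_comm, ← hD.mul_eq d hd, ← smul_mul_assoc, ← hes]
      ring
    rcases smul_eq_zero.1 h0 with h1 | h1
    · exact sub_eq_zero.1 h1
    · exact absurd ((Idem.eq_bot_iff_val _).2 h1) hne
  · left
    rw [localValue, dif_neg h]

end EndSpace

/-! ### The embedding into normal functions, its density, and the proximity. -/

namespace FN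

open EndSpace

variable {A S : Type*} [CommRing A] [LinearOrder A] [CommRing S] [Algebra A S]
  {R : Idem S → Idem S → Prop}

section Representation

variable [IsDomain A] [Module.IsTorsionFree A S]
  (hcov : ∀ s : S, ∃ (D : Finset (Idem S)) (v : Idem S → A), IsConstCover s D v)

/-- The normal function represented by an element of a Specker algebra. -/
noncomputable def represent (R : Idem S → Idem S → Prop) (s : S) : FN (EndSpace R) A :=
  normalize (localValue A s) (finite_range_localValue (hcov s))

theorem represent_apply {x : EndSpace R} {s : S} {a : A} (h : HasValue x s a) :
    represent hcov R s x = a := by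
  rw [represent, normalize_apply_of_eventually, h.localValue_eq]
  filter_upwards [eventually_hasValue h] with y hy
  rw [h.localValue_eq, hy.localValue_eq]

/-- The union of the U_d over a cover of 1 is dense. Identities between normal functions are checked
where all the elements involved have values. -/
theorem eventually_hasValue_represent (hR : IsDeVries R) (s : S) :
    ∀ᶠ x in denseFilter (EndSpace R), HasValue x s (represent hcov R s x) := by
  obtain ⟨D, v, hD⟩ := hcov s
  filter_upwards [hR.eventually_exists_mem_regularOpen D hD.sup_eq_top] with x hx
  obtain ⟨d, hd, hxd⟩ := hx
  have h : HasValue x s (v d) := ⟨d, hxd, hD.mul_eq d hd⟩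
  rwa [represent_apply hcov h]

theorem represent_algebraMap (a : A) :
    represent hcov R (algebraMap A S a) = algebraMap A (FN (EndSpace R) A) a :=
  DFunLike.ext _ _ fun x => represent_apply hcov (hasValue_algebraMap x a)

/-- The representation as a homomorphism of algebras. -/
noncomputable def representHom (hR : IsDeVries R) : S →ₐ[A] FN (EndSpace R) A where
  toFun := represent hcov R
  map_one' := by simpa using represent_algebraMap hcov (R := R) 1
  map_zero' := by simpa using represent_algebraMap hcov (R := R) 0
  map_add' s t := ext_eventually <| by
    filter_upwards [eventually_hasValue_represent hcov hR s,
      eventually_hasValue_represent hcov hR t, add_ev (represent hcov R s) (represent hcov R t)]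
      with x hs ht h
    rw [h, represent_apply hcov (hs.add ht)]
  map_mul' s t := ext_eventually <| by
    filter_upwards [eventually_hasValue_represent hcov hR s,
      eventually_hasValue_represent hcov hR t, mul_ev (represent hcov R s) (represent hcov R t)]
      with x hs ht h
    rw [h, represent_apply hcov (hs.mul ht)]
  commutes' := represent_algebraMap hcov

theorem representHom_apply (hR : IsDeVries R) (s : S) :
    representHom hcov hR s = represent hcov R s := rfl

/-- Each nonzero e in a cover has a nonempty U_e, where the image of s takes the value of s on e. If
the image is zero, s vanishes on every member of the cover, hence on their join 1. -/
theorem representHom_injective (hR : IsDeVries R) :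
    Function.Injective (representHom hcov hR) := by
  rw [injective_iff_map_eq_zero]
  intro s hs
  obtain ⟨D, v, hD⟩ := hcov s
  have h0 : ∀ e ∈ D, e.1 * s = 0 := by
    intro e he
    by_cases hne : e = ⊥
    · rw [hne, Idem.val_bot, zero_mul]
    · obtain ⟨x, hx⟩ := hR.regularOpen_nonempty hne
      have hv : represent hcov R s x = v e := represent_apply hcov ⟨e, hx, hD.mul_eq e he⟩
      rw [← representHom_apply hcov hR, hs, zero_apply] at hv
      rw [hD.mul_eq e he, ← hv, zero_smul]
  have h1 : ∀ E : Finset (Idem S), (∀ e ∈ E, e.1 * s = 0) → (E.sup id).1 * s = 0 := by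
    classical
    intro E
    induction E using Finset.induction_on with
    | empty => simp [Idem.val_bot]
    | insert a E _ ih =>
      intro hE
      have ha := hE a (Finset.mem_insert_self a E)
      have hE' := ih fun e he => hE e (Finset.mem_insert_of_mem he)
      rw [Finset.sup_insert, Idem.val_sup]
      simp only [id]
      linear_combination ha + hE' - a.1 * hE'
  simpa [hD.sup_eq_top, Idem.val_top] using h1 D h0

end Representation

section Order

variable [IsStrictOrderedRing A] [Lattice S] [IsOrderedRing S] [IsOrderedModule A S]

theorem _root_.EndSpace.HasValue.inf (hF : IsFRing S) {x : EndSpace R} {s t : S} {a b : A}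
    (hs : HasValue x s a) (ht : HasValue x t b) : HasValue x (s ⊓ t) (a ⊓ b) := by
  obtain ⟨e, he, hes, het⟩ := hs.exists_common ht
  refine ⟨e, he, ?_⟩
  rw [Idem.mul_inf hF, hes, het]
  have : Monotone fun a : A => a • e.1 :=
    fun _ _ hab => smul_le_smul_of_nonneg_right hab (Idem.nonneg hF e)
  exact (this.map_inf a b).symm

theorem _root_.EndSpace.HasValue.sup (hF : IsFRing S) {x : EndSpace R} {s t : S} {a b : A}
    (hs : HasValue x s a) (ht : HasValue x t b) : HasValue x (s ⊔ t) (a ⊔ b) := by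
  obtain ⟨e, he, hes, het⟩ := hs.exists_common ht
  refine ⟨e, he, ?_⟩
  rw [Idem.mul_sup hF, hes, het]
  have : Monotone fun a : A => a • e.1 :=
    fun _ _ hab => smul_le_smul_of_nonneg_right hab (Idem.nonneg hF e)
  exact (this.map_sup a b).symm

variable [Module.IsTorsionFree A S]
  (hcov : ∀ s : S, ∃ (D : Finset (Idem S)) (v : Idem S → A), IsConstCover s D v)

theorem represent_inf (hR : IsDeVries R) (hF : IsFRing S) (s t : S) :
    represent hcov R (s ⊓ t) = represent hcov R s ⊓ represent hcov R t :=
  ext_eventually <| by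
    filter_upwards [eventually_hasValue_represent hcov hR s,
      eventually_hasValue_represent hcov hR t] with x hs ht
    rw [inf_apply, represent_apply hcov (hs.inf hF ht)]

theorem represent_sup (hR : IsDeVries R) (hF : IsFRing S) (s t : S) :
    represent hcov R (s ⊔ t) = represent hcov R s ⊔ represent hcov R t :=
  ext_eventually <| by
    filter_upwards [eventually_hasValue_represent hcov hR s,
      eventually_hasValue_represent hcov hR t, sup_ev (represent hcov R s) (represent hcov R t)]
      with x hs ht h
    rw [h, represent_apply hcov (hs.sup hF ht)]

/-- The upper level sets of the normal function of `s` are given by threshold idempotents. -/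
theorem represent_preimage_Ici (hR : IsDeVries R) (hF : IsFRing S) {s : S} {a : A} {c : Idem S}
    (hc : IsThreshold s a c) : represent hcov R s ⁻¹' Ici a = EndSpace.regularOpen R c := by
  have hev := eventually_hasValue_represent hcov hR s
  -- Both sides are regular open, so each inclusion need only be checked on a dense open set, at
  -- points where s has a value.
  apply Subset.antisymm
  · rw [← hR.interior_closure_regularOpen c]
    refine interior_maximal (subset_closure_of_eventually (isOpen_preimage _ a) ?_)
      (isOpen_preimage _ a)
    filter_upwards [hev] with x hx hxa
    obtain ⟨e, he, hes⟩ := hx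
    refine regularOpen_mono (hc.le hF ?_) he
    rw [hes]
    exact smul_le_smul_of_nonneg_right hxa (Idem.nonneg hF e)
  · rw [← (represent hcov R s).regularOpen' a]
    refine interior_maximal (subset_closure_of_eventually (isOpen_regularOpen c) ?_)
      (isOpen_regularOpen c)
    filter_upwards [hev] with x hx hxc
    obtain ⟨e, he, hes⟩ := hx
    have hne : (e ⊓ c).1 ≠ 0 := fun h0 => by
      refine ne_bot_of_mem_regularOpen (r := R) (a := e ⊓ c) (x := x) ?_
        ((Idem.eq_bot_iff_val _).2 h0)
      rw [regularOpen_inf]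
      exact ⟨he, hxc⟩
    refine Idem.le_of_smul_le_smul hF hne ?_
    have h1 := mul_le_mul_of_nonneg_left hc.1 (Idem.nonneg hF e)
    rwa [mul_smul_comm, mul_left_comm, hes, mul_smul_comm, mul_comm c.1 e.1] at h1

/-- An element with the value `b` on the idempotent `c` and the value `m` off it. -/
theorem prox_represent_step (hR : IsDeVries R) (hF : IsFRing S) {m b : A} (hmb : m ≤ b)
    {c : Idem S} {g : FN (EndSpace R) A} (hm : ∀ x, m ≤ g x)
    (hg : closure (EndSpace.regularOpen R c) ⊆ g ⁻¹' Ici b) :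
    prox (represent hcov R (algebraMap A S m + (b - m) • c.1)) g := by
  set u := algebraMap A S m + (b - m) • c.1 with hu
  intro a
  -- For a ≤ m the level set of g is everything; for m < a ≤ b the threshold of u is c; for b < a it
  -- is ⊥.
  rcases le_or_gt a m with ham | hma
  · exact fun x _ => ham.trans (hm x)
  rcases le_or_gt a b with hab | hba
  · have ht : IsThreshold u a c := by
      refine ⟨?_, m, hma, ?_⟩
      · rw [hu, mul_add, mul_algebraMap_eq_smul, mul_smul_comm, c.mul_self, ← add_smul,
          add_sub_cancel]
        exact smul_le_smul_of_nonneg_right hab (Idem.nonneg hF c)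
      · rw [hu, mul_add, mul_algebraMap_eq_smul, mul_smul_comm, c.compl_mul, smul_zero, add_zero]
    rw [represent_preimage_Ici hcov hR hF ht]
    exact hg.trans (preimage_mono (Ici_subset_Ici.2 hab))
  · have ht : IsThreshold u a (⊥ : Idem S) := by
      refine ⟨by simp [Idem.val_bot], b, hba, ?_⟩
      rw [Idem.val_bot, sub_zero, one_mul, hu, Algebra.algebraMap_eq_smul_one]
      calc m • (1 : S) + (b - m) • c.1 ≤ m • (1 : S) + (b - m) • (1 : S) :=
            add_le_add_right
              (smul_le_smul_of_nonneg_left (Idem.le_one hF c) (sub_nonneg.2 hmb)) _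
        _ = b • (1 : S) := by rw [← add_smul, add_sub_cancel]
    rw [represent_preimage_Ici hcov hR hF ht, regularOpen_bot, closure_empty]
    exact empty_subset _

theorem isProxDense_range_represent (hR : IsDeVries R) (hF : IsFRing S) :
    IsProxDense prox (range (represent hcov R)) := by
  classical
  intro f g hfg
  obtain ⟨m, hm⟩ := (f.finite_range'.union g.finite_range').bddBelow
  have hmf : ∀ x, m ≤ f x := fun x => hm (.inl (mem_range_self x))
  have hmg : ∀ x, m ≤ g x := fun x => hm (.inr (mem_range_self x))
  have key : ∀ F : Finset A, ↑F ⊆ range f → ∃ s : S, prox (represent hcov R s) g ∧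
      ∀ b ∈ F, closure (f ⁻¹' Ici b) ⊆ represent hcov R s ⁻¹' Ici b := by
    intro F
    induction F using Finset.induction_on with
    | empty =>
      refine fun _ => ⟨algebraMap A S m, ?_, by simp⟩
      simpa using prox_represent_step hcov hR hF le_rfl (c := ⊥) hmg
        (by simp [regularOpen_bot])
    | insert b F _ ih =>
      intro hbF
      rw [Finset.coe_insert, insert_subset_iff] at hbF
      obtain ⟨s, hsg, hs⟩ := ih hbF.2
      have hmb : m ≤ b := hm (.inl hbF.1)
      -- The step with value b on c and m off it stays proximal to g and reaches b on the closure of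
      -- the level set of f.
      obtain ⟨c, hc, hcg⟩ := hR.exists_regularOpen_between isClosed_closure
        (g.isOpen_preimage b) (hfg b)
      refine ⟨s ⊔ (algebraMap A S m + (b - m) • c.1), ?_, ?_⟩
      · rw [represent_sup hcov hR hF]
        exact prox_sup hsg (prox_represent_step hcov hR hF hmb hmg hcg)
      · rw [represent_sup hcov hR hF]
        intro d hd x hx
        rcases Finset.mem_insert.1 hd with rfl | hd
        · refine le_trans ?_ ((le_sup_right : represent hcov R _ ≤ represent hcov R s ⊔ _) x)
          refine (represent_apply hcov ⟨c, hc hx, ?_⟩).ge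
          rw [mul_add, mul_algebraMap_eq_smul, mul_smul_comm, c.mul_self, ← add_smul,
            add_sub_cancel]
        · exact le_trans (hs d hd hx)
            ((le_sup_left : represent hcov R s ≤ represent hcov R s ⊔ _) x)
  obtain ⟨s, hsg, hs⟩ := key f.finite_range'.toFinset (by simp)
  refine ⟨_, mem_range_self s, fun a => ?_, hsg⟩
  -- The level set of f at a is the one at the least value b ≥ a of f, or empty if there is no such
  -- value.
  by_cases hne : (range f ∩ Ici a).Nonempty
  · obtain ⟨b, hb, hmin⟩ := (f.finite_range'.subset inter_subset_left).exists_minimal hne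
    have heq : f ⁻¹' Ici a ⊆ f ⁻¹' Ici b := fun y hy => by
      rcases le_total b (f y) with h | h
      · exact h
      · exact hmin ⟨mem_range_self y, hy⟩ h
    exact ((closure_mono heq).trans (hs b (by simpa using hb.1))).trans
      (preimage_mono (Ici_subset_Ici.2 hb.2))
  · have : f ⁻¹' Ici a = ∅ := eq_empty_of_forall_notMem fun y hy =>
      hne ⟨f y, mem_range_self y, hy⟩
    rw [this, closure_empty]
    exact empty_subset _

theorem prox_represent_iff {r : S → S → Prop} (hr : IsProximity A r)
    (hR : IsDeVries (Idem.restrict r)) (hF : IsFRing S) (s t : S) :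
    r s t ↔ prox (represent hcov (Idem.restrict r) s) (represent hcov (Idem.restrict r) t) := by
  rw [hr.iff_forall_isThreshold hF hcov]
  have key : ∀ (a : A) (c d : Idem S), IsThreshold s a c → IsThreshold t a d →
      (r c.1 d.1 ↔ closure (represent hcov (Idem.restrict r) s ⁻¹' Ici a) ⊆
        represent hcov (Idem.restrict r) t ⁻¹' Ici a) := fun a c d hc hd => by
    rw [represent_preimage_Ici hcov hR hF hc, represent_preimage_Ici hcov hR hF hd,
      hR.closure_regularOpen_subset_iff, Idem.restrict]
  constructor
  · intro h a
    obtain ⟨D, v, hD⟩ := hcov s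
    obtain ⟨E, w, hE⟩ := hcov t
    have hc := hD.isThreshold hF a
    have hd := hE.isThreshold hF a
    exact (key a _ _ hc hd).1 (h a _ _ hc hd)
  · exact fun h a c d hc hd => (key a c d hc hd).2 (h a)

end Order

end FN

theorem mainTheorem2 {A S : Type*} [CommRing A] [LinearOrder A] [IsStrictOrderedRing A]
    [CommRing S] [Lattice S] [Algebra A S] (r : S → S → Prop) (h : IsProximitySpecker A r) :
    CompactSpace (EndSpace (Idem.restrict r)) ∧ T2Space (EndSpace (Idem.restrict r)) ∧
    ∃ η : S →ₐ[A] FN (EndSpace (Idem.restrict r)) A,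
      (∀ s t, η (s ⊓ t) = η s ⊓ η t) ∧
      (∀ s t, η (s ⊔ t) = η s ⊔ η t) ∧
      Function.Injective η ∧
      IsProxDense FN.prox (Set.range η) ∧
      ∀ s t, r s t ↔ FN.prox (η s) (η t) := by
  have hF := h.isFAlgebra.isFRing
  have := h.isFAlgebra.isOrderedRing
  have := h.isFAlgebra.isOrderedModule
  have := h.torsionFree
  have hcov := h.isSpecker.exists_isConstCover
  have hR := h.isProximity.restrict_isDeVries hF hcov
  exact ⟨hR.compactSpace, hR.t2Space, FN.representHom hcov hR, FN.represent_inf hcov hR hF,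
    FN.represent_sup hcov hR hF, FN.representHom_injective hcov hR,
    FN.isProxDense_range_represent hcov hR hF,
    FN.prox_represent_iff hcov h.isProximity hR hF⟩
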